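/- Let $N\ge 1$. For a measurable $\phi:\mathbb{R}^N\to\mathbb{R}$ put $\|\phi\|_{L^1_{\rm ul}}:=\sup_{y\in\mathbb{R}^N}\int_{B(y,1)}|\phi(x)|\,dx$, where $B(y,1)$ is the open unit ball centred at $y$. Let $L^1_{\rm ul}(\mathbb{R}^N)$ be the space of all $\phi$ with $\|\phi\|_{L^1_{\rm ul}}<\infty$, and let $\mathcal{L}^1_{\rm ul}(\mathbb{R}^N)$ be the closure in $L^1_{\rm ul}(\mathbb{R}^N)$ of the space of bounded uniformly continuous functions on $\mathbb{R}^N$. Let $$S(t)[\phi](x):=\int_{\mathbb{R}^N}(4\pi t)^{-N/2}e^{-|x-y|^2/(4t)}\phi(y)\,dy .$$ A nonnegative solution on $(0,T)$ of $$\partial_t u=\Delta u+f(u)\ \text{ in }\mathbb{R}^N\times(0,T),\qquad u(x,0)=u_0(x)\ \text{ in }\mathbb{R}^N, \tag{1}$$ is a nonnegative measurable function $u\in L^\infty((0,T),L^1_{\rm ul}(\mathbb{R}^N))\cap L^\infty_{\rm loc}((0,T),L^\infty(\mathbb{R}^N))$ such that, for every $0<t<T$ and a.e. $x\in\mathbb{R}^N$,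 $$\infty>u(t)=S(t)u_0+\int_0^tS(t-s)f(u(s))\,ds .$$ **Theorem.** Let $u_0\ge 0$ be a measurable function on $\mathbb{R}^N$. Suppose that $f\in C[0,\infty)$ is nonnegative and is nondecreasing for $u>0$. Suppose that $J\in C^2[0,\infty)$, $\lim_{u\to\infty}J(u)=\infty$, $J(u)>0$ and $J'(u)>0$ for $u>0$, and $J'(u)$ is nondecreasing for large $u$. For $\theta\in(0,1]$ and $\xi\ge 0$ define, with values in $[0,\infty]$, $$\tilde f(u):=\sup_{\xi\le\tau\le u}\frac{f(\tau)}{J(\tau)^{\theta}},\qquad \tilde J(u):=\sup_{\xi\le\tau\le u}\frac{J'(\tau)}{J(\tau)^{1-\theta}} .$$ Suppose that there exist $\theta\in(0,1]$ and $\xi\ge0$ such that one of the following holds: (i) $J(u_0)\in L^1_{\rm ul}(\mathbb{R}^N)$ and $\displaystyle\lim_{\eta\to\infty}\tilde J(\eta)\int_\eta^\infty\frac{\tilde f(\tau)J'(\tau)}{J(\tau)^{1+2/N}}\,d\tau=0$; (ii) $J(u_0)\in\mathcal{L}^1_{\rm ul}(\mathbb{R}^N)$ and $\displaystyle\limsup_{\eta\to\infty}\tilde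 J(\eta)\int_\eta^\infty\frac{\tilde f(\tau)J'(\tau)}{J(\tau)^{1+2/N}}\,d\tau<\infty$. Then there exist $T>0$ and a nonnegative solution $u$ of (1) on $(0,T)$. Moreover, there exists $C_0>0$ such that $$\|J(u(t))\|_{L^1_{\rm ul}(\mathbb{R}^N)}\le C_0\qquad\text{for all }0<t<T .$$ -/

import Mathlib

open Set Filter Topology MeasureTheory
open scoped NNReal ENNReal

/-- The uniformly local `L^r` norm on `ℝ^N`, i.e. the supremum over all `y` of the `L^r` norm of `φ`
on the open unit ball `B(y,1)`, with values in `[0,∞]`. -/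
noncomputable def ulNorm {N : ℕ} (r : ℝ≥0∞) (φ : EuclideanSpace ℝ (Fin N) → ℝ) : ℝ≥0∞ :=
  ⨆ y : EuclideanSpace ℝ (Fin N), eLpNorm φ r (volume.restrict (Metric.ball y 1))

/-- `φ ∈ L^r_ul(ℝ^N)`. -/
def MemUL {N : ℕ} (r : ℝ≥0∞) (φ : EuclideanSpace ℝ (Fin N) → ℝ) : Prop :=
  AEStronglyMeasurable φ volume ∧ ulNorm r φ < ∞

/-- `φ` belongs to the closure of `BUC(ℝ^N)`, the space of bounded uniformly continuous functions,
in `L^r_ul(ℝ^N)`. -/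
def MemULClosure {N : ℕ} (r : ℝ≥0∞) (φ : EuclideanSpace ℝ (Fin N) → ℝ) : Prop :=
  MemUL r φ ∧ ∀ ε : ℝ≥0∞, 0 < ε → ∃ g : EuclideanSpace ℝ (Fin N) → ℝ,
    UniformContinuous g ∧ (∃ M : ℝ, ∀ x, |g x| ≤ M) ∧ ulNorm r (fun x => φ x - g x) < ε

/-- The heat kernel `K(x,y,t) = (4πt)^{-N/2} exp(-|x-y|²/(4t))`, for `t > 0`. -/
noncomputable def heatKernel {N : ℕ} (x y : EuclideanSpace ℝ (Fin N)) (t : ℝ) : ℝ :=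
  (4 * Real.pi * t) ^ (-(N : ℝ) / 2) * Real.exp (-‖x - y‖ ^ 2 / (4 * t))

/-- The heat semigroup `S(t)[φ](x) = ∫ K(x,y,t) φ(y) dy` on nonnegative functions, with values
in `[0,∞]`. -/
noncomputable def heatS {N : ℕ} (t : ℝ) (φ : EuclideanSpace ℝ (Fin N) → ℝ≥0∞)
    (x : EuclideanSpace ℝ (Fin N)) : ℝ≥0∞ :=
  ∫⁻ y, ENNReal.ofReal (heatKernel x y t) * φ y

/-- The Duhamel operator `S(t)u₀ + ∫₀ᵗ S(t-s) f(u(s)) ds` for nonnegative `u₀`, `u` and `f`, with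
values in `[0,∞]`. -/
noncomputable def duhamel {N : ℕ} (f : ℝ → ℝ) (u₀ : EuclideanSpace ℝ (Fin N) → ℝ)
    (u : ℝ → EuclideanSpace ℝ (Fin N) → ℝ) (t : ℝ) (x : EuclideanSpace ℝ (Fin N)) : ℝ≥0∞ :=
  heatS t (fun y => ENNReal.ofReal (u₀ y)) x +
    ∫⁻ s in Ioo 0 t, heatS (t - s) (fun y => ENNReal.ofReal (f (u s y))) x

/-- `u` is a nonnegative solution on `(0,T)` of `∂ₜu = Δu + f(u)` in `ℝ^N × (0,T)`, `u(0) = u₀`,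
where `u₀ ≥ 0` and `f : [0,∞) → [0,∞)`: a nonnegative measurable function in
`L^∞((0,T), L^1_ul) ∩ L^∞_loc((0,T), L^∞)` with `∞ > u(t) = S(t)u₀ + ∫₀ᵗ S(t-s) f(u(s)) ds` almost
everywhere in `ℝ^N`, for every `0 < t < T`. (The right-hand side is computed in `[0,∞]`; the
equation says in particular that it is finite.) -/
structure IsNonnegSolution {N : ℕ} (f : ℝ → ℝ) (u₀ : EuclideanSpace ℝ (Fin N) → ℝ) (T : ℝ)
    (u : ℝ → EuclideanSpace ℝ (Fin N) → ℝ) : Prop where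
  aemeasurable : AEMeasurable (Function.uncurry u) ((volume.restrict (Ioo 0 T)).prod volume)
  nonneg : ∀ t ∈ Ioo 0 T, ∀ᵐ x, 0 ≤ u t x
  bounded_ul : ∃ M : ℝ≥0, ∀ᵐ t ∂(volume.restrict (Ioo 0 T)), MemUL 1 (u t) ∧ ulNorm 1 (u t) ≤ M
  locBounded_top : ∀ a b : ℝ, 0 < a → b < T →
    ∃ M : ℝ≥0, ∀ᵐ t ∂(volume.restrict (Icc a b)), eLpNorm (u t) ∞ volume ≤ M
  equation : ∀ t ∈ Ioo 0 T, ∀ᵐ x, ENNReal.ofReal (u t x) = duhamel f u₀ u t x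

/-- Condition (J) on `J : [0,∞) → ℝ`; `derivWithin J (Ici 0)` is `J'`, one-sided at `0`. -/
structure ConditionJ (J : ℝ → ℝ) : Prop where
  contDiffOn : ContDiffOn ℝ 2 J (Ici 0)
  tendsto : Tendsto J atTop atTop
  pos : ∀ τ, 0 < τ → 0 < J τ
  deriv_pos : ∀ τ, 0 < τ → 0 < derivWithin J (Ici 0) τ
  deriv_mono : ∃ C : ℝ, 0 ≤ C ∧ MonotoneOn (derivWithin J (Ici 0)) (Ici C)

/-- `f̃(u) = sup_{ξ ≤ τ ≤ u} f(τ) / J(τ)^θ`, with values in `[0,∞]`. -/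
noncomputable def fTilde (f J : ℝ → ℝ) (θ ξ u : ℝ) : ℝ≥0∞ :=
  ⨆ τ ∈ Icc ξ u, ENNReal.ofReal (f τ) / ENNReal.ofReal (J τ ^ θ)

/-- `J̃(u) = sup_{ξ ≤ τ ≤ u} J'(τ) / J(τ)^{1-θ}`, with values in `[0,∞]`. -/
noncomputable def JTilde (J : ℝ → ℝ) (θ ξ u : ℝ) : ℝ≥0∞ :=
  ⨆ τ ∈ Icc ξ u, ENNReal.ofReal (derivWithin J (Ici 0) τ) / ENNReal.ofReal (J τ ^ (1 - θ))

/-- `J̃(η) ∫_η^∞ f̃(τ) J'(τ) / J(τ)^{1+2/N} dτ`, with values in `[0,∞]`. -/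
noncomputable def tailQuantity (N : ℕ) (f J : ℝ → ℝ) (θ ξ η : ℝ) : ℝ≥0∞ :=
  JTilde J θ ξ η * ∫⁻ τ in Ioi η,
    fTilde f J θ ξ τ * ENNReal.ofReal (derivWithin J (Ici 0) τ) /
      ENNReal.ofReal (J τ ^ (1 + 2 / (N : ℝ)))

/-! ### The heat semigroup on `[0,∞]`-valued functions and uniformly local mass. -/

section HeatSemigroup

variable {N : ℕ}

/-! The linear heat flow of `J(u₀)`, pulled back by `J⁻¹`, yields a supersolution. Put m = max(u₀,
R), with R so large that J is convex on [R,∞), and let I be the inverse of J there. The candidate is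
w(t) = I(2W), where W = S(t)J(m). Jensen's inequality for J gives S(t)m ≤ I(W)
(`ConditionJ.heatS_le_inverse`), so the factor 2 leaves the gap I(2W) − I(W) to absorb the Duhamel
integral.

In that integral f(w(s)) ≤ f̃(w(s)) (2S(s)J(m))^θ. The smoothing estimate `exists_heatS_le_ulMass`
leads to 2S(s)J(m) ≤ κ s^{-N/2} for small s, so f̃ may be evaluated at I(κ s^{-N/2}), independently
of x. Jensen's inequality for the power θ and the semigroup property turn the other factor into
(2W)^θ. The integral is thus at most A(2W)^θ with A = ∫₀ᵗ f̃(I(κ s^{-N/2})) ds, which the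
substitution J(τ) = κ s^{-N/2} compares with the tail integral of the hypothesis
(`ConditionJ.lintegral_inverse_le`). The mean value theorem gives W ≤ J̃ (2W)^{1-θ} (I(2W) − I(W)),
so A J̃ ≤ 1/2 suffices (`ConditionJ.inverse_add_le`, `ConditionJ.duhamel_le`).

In case (i) the tail quantity tends to zero and any κ will do. In case (ii) it is only bounded, but
κ can be made small: a bounded approximant of `J(u₀)` adds only a constant to the flow, negligible
against t^{-N/2}. Monotone iteration from zero then produces a solution u ≤ w
(`exists_solution_le_supersolution`). Since J(u) ≤ 2W and the semigroup contracts uniformly local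
mass, the bound on J(u) follows. -/

theorem heatKernel_nonneg (x y : EuclideanSpace ℝ (Fin N)) {t : ℝ} (ht : 0 < t) :
    0 ≤ heatKernel x y t := by
  unfold heatKernel
  positivity

theorem heatKernel_comm (x y : EuclideanSpace ℝ (Fin N)) (t : ℝ) :
    heatKernel x y t = heatKernel y x t := by
  unfold heatKernel
  rw [norm_sub_rev]

theorem measurable_heatKernel {α : Type*} [MeasurableSpace α]
    {X Y : α → EuclideanSpace ℝ (Fin N)} {τ : α → ℝ}
    (hX : Measurable X) (hY : Measurable Y) (hτ : Measurable τ) :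
    Measurable fun a => heatKernel (X a) (Y a) (τ a) := by
  unfold heatKernel
  fun_prop

theorem lintegral_heatKernel_left (y : EuclideanSpace ℝ (Fin N)) {t : ℝ} (ht : 0 < t) :
    ∫⁻ x, ENNReal.ofReal (heatKernel x y t) = 1 := by
  have hb : 0 < 1 / (4 * t) := by positivity
  have hI := GaussianFourier.integral_rexp_neg_mul_sq_norm (V := EuclideanSpace ℝ (Fin N)) hb
  have hpos : 0 < (Real.pi / (1 / (4 * t))) ^ ((Module.finrank ℝ (EuclideanSpace ℝ (Fin N)) : ℝ) / 2) := by
    positivity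
  -- A non-integrable function has Bochner integral 0, whereas the Gaussian formula gives a positive
  -- value.
  have hint : Integrable fun v : EuclideanSpace ℝ (Fin N) => Real.exp (-(1 / (4 * t)) * ‖v‖ ^ 2) := by
    by_contra h
    rw [integral_undef h] at hI
    exact hpos.ne hI
  have h1 : ∀ x : EuclideanSpace ℝ (Fin N), ENNReal.ofReal (heatKernel x y t) =
      ENNReal.ofReal ((4 * Real.pi * t) ^ (-(N : ℝ) / 2)) *
        ENNReal.ofReal (Real.exp (-(1 / (4 * t)) * ‖x - y‖ ^ 2)) := by
    intro x
    rw [← ENNReal.ofReal_mul (by positivity), heatKernel]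
    congr 3
    field_simp
  simp_rw [h1]
  rw [lintegral_const_mul' _ _ ENNReal.ofReal_ne_top,
    lintegral_sub_right_eq_self
      (fun v : EuclideanSpace ℝ (Fin N) => ENNReal.ofReal (Real.exp (-(1 / (4 * t)) * ‖v‖ ^ 2))) y,
    ← ofReal_integral_eq_lintegral_ofReal hint (Eventually.of_forall fun _ => (Real.exp_pos _).le),
    hI, ← ENNReal.ofReal_mul (by positivity), finrank_euclideanSpace_fin]
  have h2 : Real.pi / (1 / (4 * t)) = 4 * Real.pi * t := by field_simp
  rw [h2, ← Real.rpow_add (by positivity)]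
  simp [neg_div]

theorem lintegral_heatKernel_right (x : EuclideanSpace ℝ (Fin N)) {t : ℝ} (ht : 0 < t) :
    ∫⁻ y, ENNReal.ofReal (heatKernel x y t) = 1 := by
  simp_rw [heatKernel_comm x]
  exact lintegral_heatKernel_left x ht

/-- Completing the square in a product of two heat kernels. -/
theorem heatKernel_mul_heatKernel (x y z : EuclideanSpace ℝ (Fin N)) {a b : ℝ}
    (ha : 0 < a) (hb : 0 < b) :
    heatKernel x z a * heatKernel z y b = heatKernel x y (a + b) *
      heatKernel z ((a + b)⁻¹ • (b • x + a • y)) (a * b / (a + b)) := by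
  have hab : 0 < a + b := by positivity
  unfold heatKernel
  have h1 : z - (a + b)⁻¹ • (b • x + a • y) = (a + b)⁻¹ • (a • (z - y) - b • (x - z)) := by
    have : z = (a + b)⁻¹ • ((a + b) • z) := by rw [inv_smul_smul₀ hab.ne']
    nth_rewrite 1 [this]
    rw [← smul_sub]
    congr 1
    module
  have h2 : x - y = (x - z) + (z - y) := by abel
  rw [h1, h2]
  generalize x - z = p
  generalize z - y = q
  rw [norm_smul, mul_pow, norm_add_sq_real, norm_sub_sq_real, norm_smul, norm_smul,
    inner_smul_left, inner_smul_right, real_inner_comm q p]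
  simp only [Real.norm_eq_abs, abs_of_pos ha, abs_of_pos hb, abs_inv, abs_of_pos hab,
    conj_trivial]
  rw [mul_mul_mul_comm ((4 * Real.pi * a) ^ _), mul_mul_mul_comm ((4 * Real.pi * (a + b)) ^ _),
    ← Real.exp_add, ← Real.exp_add,
    ← Real.mul_rpow (by positivity) (by positivity), ← Real.mul_rpow (by positivity) (by positivity)]
  congr 2
  · field_simp
  · field_simp
    ring

theorem lintegral_heatKernel_mul_heatKernel (x y : EuclideanSpace ℝ (Fin N)) {a b : ℝ}
    (ha : 0 < a) (hb : 0 < b) :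
    ∫⁻ z, ENNReal.ofReal (heatKernel x z a) * ENNReal.ofReal (heatKernel z y b) =
      ENNReal.ofReal (heatKernel x y (a + b)) := by
  have hab : 0 < a + b := by positivity
  simp_rw [← ENNReal.ofReal_mul (heatKernel_nonneg _ _ ha), heatKernel_mul_heatKernel x y _ ha hb,
    ENNReal.ofReal_mul (heatKernel_nonneg _ _ hab)]
  rw [lintegral_const_mul' _ _ ENNReal.ofReal_ne_top, lintegral_heatKernel_left _ (by positivity),
    mul_one]

theorem heatS_mono {φ ψ : EuclideanSpace ℝ (Fin N) → ℝ≥0∞} (h : ∀ x, φ x ≤ ψ x) (t : ℝ)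
    (x : EuclideanSpace ℝ (Fin N)) : heatS t φ x ≤ heatS t ψ x :=
  lintegral_mono fun y => mul_le_mul_right (h y) _

theorem heatS_congr_ae {φ ψ : EuclideanSpace ℝ (Fin N) → ℝ≥0∞} (h : φ =ᵐ[volume] ψ) (t : ℝ)
    (x : EuclideanSpace ℝ (Fin N)) : heatS t φ x = heatS t ψ x :=
  lintegral_congr_ae (h.mono fun y hy => by simp only [hy])

theorem heatS_const (c : ℝ≥0∞) {t : ℝ} (ht : 0 < t) (x : EuclideanSpace ℝ (Fin N)) :
    heatS t (fun _ => c) x = c := by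
  unfold heatS
  rw [lintegral_mul_const _ (by
    exact (measurable_heatKernel measurable_const measurable_id measurable_const).ennreal_ofReal),
    lintegral_heatKernel_right x ht, one_mul]

theorem heatS_const_mul (c : ℝ≥0∞) {φ : EuclideanSpace ℝ (Fin N) → ℝ≥0∞} (hφ : Measurable φ)
    (t : ℝ) (x : EuclideanSpace ℝ (Fin N)) : heatS t (fun y => c * φ y) x = c * heatS t φ x := by
  unfold heatS
  have hm : Measurable fun y => ENNReal.ofReal (heatKernel x y t) * φ y :=
    (measurable_heatKernel measurable_const measurable_id measurable_const).ennreal_ofReal.mul hφ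
  rw [← lintegral_const_mul _ hm]
  exact lintegral_congr fun y => by ring

theorem heatS_add {φ ψ : EuclideanSpace ℝ (Fin N) → ℝ≥0∞} (hφ : Measurable φ) (t : ℝ)
    (x : EuclideanSpace ℝ (Fin N)) :
    heatS t (fun y => φ y + ψ y) x = heatS t φ x + heatS t ψ x := by
  unfold heatS
  simp_rw [mul_add]
  exact lintegral_add_left
    ((measurable_heatKernel measurable_const measurable_id measurable_const).ennreal_ofReal.mul hφ) _

theorem heatS_iSup {φ : ℕ → EuclideanSpace ℝ (Fin N) → ℝ≥0∞} (hφ : ∀ n, Measurable (φ n))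
    (hmono : Monotone φ) (t : ℝ) (x : EuclideanSpace ℝ (Fin N)) :
    heatS t (fun y => ⨆ n, φ n y) x = ⨆ n, heatS t (φ n) x := by
  unfold heatS
  simp_rw [ENNReal.mul_iSup]
  exact lintegral_iSup
    (fun n => (measurable_heatKernel measurable_const measurable_id
      measurable_const).ennreal_ofReal.mul (hφ n))
    (fun m n h y => mul_le_mul_right (hmono h y) _)

theorem measurable_heatS {α : Type*} [MeasurableSpace α] {τ : α → ℝ}
    {X : α → EuclideanSpace ℝ (Fin N)} {φ : α → EuclideanSpace ℝ (Fin N) → ℝ≥0∞}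
    (hτ : Measurable τ) (hX : Measurable X) (hφ : Measurable (Function.uncurry φ)) :
    Measurable fun a => heatS (τ a) (φ a) (X a) := by
  unfold heatS
  refine Measurable.lintegral_prod_right' (f := fun p : α × EuclideanSpace ℝ (Fin N) =>
    ENNReal.ofReal (heatKernel (X p.1) p.2 (τ p.1)) * φ p.1 p.2) ?_
  exact (measurable_heatKernel (hX.comp measurable_fst) measurable_snd
    (hτ.comp measurable_fst)).ennreal_ofReal.mul hφ

theorem measurable_heatS_right {φ : EuclideanSpace ℝ (Fin N) → ℝ≥0∞} (hφ : Measurable φ) (t : ℝ) :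
    Measurable (heatS t φ) :=
  measurable_heatS (φ := fun _ => φ) measurable_const measurable_id (hφ.comp measurable_snd)

/-- The semigroup property. -/
theorem heatS_heatS {φ : EuclideanSpace ℝ (Fin N) → ℝ≥0∞} (hφ : Measurable φ) {a b : ℝ}
    (ha : 0 < a) (hb : 0 < b) (x : EuclideanSpace ℝ (Fin N)) :
    heatS a (heatS b φ) x = heatS (a + b) φ x := by
  unfold heatS
  have h1 : ∀ z : EuclideanSpace ℝ (Fin N), ENNReal.ofReal (heatKernel x z a) *
      ∫⁻ y, ENNReal.ofReal (heatKernel z y b) * φ y =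
      ∫⁻ y, ENNReal.ofReal (heatKernel x z a) * (ENNReal.ofReal (heatKernel z y b) * φ y) :=
    fun z => (lintegral_const_mul' _ _ ENNReal.ofReal_ne_top).symm
  simp_rw [h1]
  rw [lintegral_lintegral_swap]
  · refine lintegral_congr fun y => ?_
    simp_rw [← mul_assoc]
    rw [lintegral_mul_const, lintegral_heatKernel_mul_heatKernel x y ha hb]
    exact (measurable_heatKernel measurable_const measurable_id measurable_const).ennreal_ofReal.mul
      (measurable_heatKernel measurable_id measurable_const measurable_const).ennreal_ofReal
  · exact ((measurable_heatKernel measurable_const measurable_fst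
      measurable_const).ennreal_ofReal.mul
      ((measurable_heatKernel measurable_fst measurable_snd measurable_const).ennreal_ofReal.mul
        (hφ.comp measurable_snd))).aemeasurable

/-- Jensen's inequality for the heat semigroup and the power `θ ∈ (0,1]`. -/
theorem heatS_rpow_le {φ : EuclideanSpace ℝ (Fin N) → ℝ≥0∞} (hφ : Measurable φ) {θ : ℝ}
    (hθ : θ ∈ Ioc (0 : ℝ) 1) {t : ℝ} (ht : 0 < t) (x : EuclideanSpace ℝ (Fin N)) :
    heatS t (fun y => φ y ^ θ) x ≤ heatS t φ x ^ θ := by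
  have hK : Measurable fun y => ENNReal.ofReal (heatKernel x y t) :=
    (measurable_heatKernel measurable_const measurable_id measurable_const).ennreal_ofReal
  -- Hölder with weights θ and 1 - θ, applied to K φ^θ = (K φ)^θ K^{1-θ}; the second factor
  -- integrates to 1.
  have h := ENNReal.lintegral_mul_norm_pow_le (μ := volume) (hK.mul hφ).aemeasurable
    hK.aemeasurable hθ.1.le (sub_nonneg.2 hθ.2) (add_sub_cancel θ 1)
  rw [lintegral_heatKernel_right x ht, ENNReal.one_rpow, mul_one] at h
  refine le_trans (le_of_eq (lintegral_congr fun y => ?_)) h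
  simp only [Pi.mul_apply]
  rw [ENNReal.mul_rpow_of_nonneg _ _ hθ.1.le, mul_right_comm,
    ← ENNReal.rpow_add_of_nonneg _ _ hθ.1.le (sub_nonneg.2 hθ.2), add_sub_cancel, ENNReal.rpow_one]

/-- The uniformly local mass of a `[0,∞]`-valued function. -/
noncomputable def ulMass (φ : EuclideanSpace ℝ (Fin N) → ℝ≥0∞) : ℝ≥0∞ :=
  ⨆ y : EuclideanSpace ℝ (Fin N), ∫⁻ x in Metric.ball y 1, φ x

theorem setLIntegral_ball_le_ulMass (φ : EuclideanSpace ℝ (Fin N) → ℝ≥0∞)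
    (y : EuclideanSpace ℝ (Fin N)) : ∫⁻ x in Metric.ball y 1, φ x ≤ ulMass φ :=
  le_iSup (fun y => ∫⁻ x in Metric.ball y 1, φ x) y

theorem ulNorm_one_eq_ulMass (φ : EuclideanSpace ℝ (Fin N) → ℝ) :
    ulNorm 1 φ = ulMass fun x => ‖φ x‖ₑ := by
  simp only [ulNorm, ulMass, eLpNorm_one_eq_lintegral_enorm]

theorem ulMass_mono_ae {φ ψ : EuclideanSpace ℝ (Fin N) → ℝ≥0∞} (h : ∀ᵐ x, φ x ≤ ψ x) :
    ulMass φ ≤ ulMass ψ :=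
  iSup_mono fun _ => lintegral_mono_ae (ae_restrict_of_ae h)

theorem ulMass_mono {φ ψ : EuclideanSpace ℝ (Fin N) → ℝ≥0∞} (h : ∀ x, φ x ≤ ψ x) :
    ulMass φ ≤ ulMass ψ :=
  ulMass_mono_ae (Eventually.of_forall h)

theorem ulMass_const_mul {c : ℝ≥0∞} (hc : c ≠ ∞) (φ : EuclideanSpace ℝ (Fin N) → ℝ≥0∞) :
    ulMass (fun x => c * φ x) = c * ulMass φ := by
  unfold ulMass
  rw [ENNReal.mul_iSup]
  exact iSup_congr fun y => lintegral_const_mul' _ _ hc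

theorem ulMass_const_add_le (c : ℝ≥0∞) (φ : EuclideanSpace ℝ (Fin N) → ℝ≥0∞) :
    ulMass (fun x => c + φ x) ≤
      c * volume (Metric.ball (0 : EuclideanSpace ℝ (Fin N)) 1) + ulMass φ := by
  refine iSup_le fun y => ?_
  rw [lintegral_add_left measurable_const, setLIntegral_const, Measure.addHaar_ball_center]
  gcongr
  exact setLIntegral_ball_le_ulMass φ y

/-- The heat semigroup is a contraction for the uniformly local mass. -/
theorem ulMass_heatS_le {φ : EuclideanSpace ℝ (Fin N) → ℝ≥0∞} (hφ : Measurable φ) {t : ℝ}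
    (ht : 0 < t) : ulMass (heatS t φ) ≤ ulMass φ := by
  refine iSup_le fun z => ?_
  -- In convolution form each shift h only moves the unit ball, and the supremum over centres
  -- ignores the move.
  have h1 : ∀ x : EuclideanSpace ℝ (Fin N), heatS t φ x =
      ∫⁻ h, ENNReal.ofReal (heatKernel h 0 t) * φ (x - h) := by
    intro x
    rw [← lintegral_sub_left_eq_self _ x]
    unfold heatS heatKernel
    simp
  simp_rw [h1]
  rw [lintegral_lintegral_swap]
  · calc ∫⁻ h, ∫⁻ x in Metric.ball z 1, ENNReal.ofReal (heatKernel h 0 t) * φ (x - h)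
        ≤ ∫⁻ h, ENNReal.ofReal (heatKernel (N := N) h 0 t) * ulMass φ := by
          refine lintegral_mono fun h => ?_
          rw [lintegral_const_mul' _ _ ENNReal.ofReal_ne_top]
          gcongr
          have h2 : ∫⁻ x in Metric.ball z 1, φ (x - h) = ∫⁻ x in Metric.ball (z - h) 1, φ x := by
            rw [← lintegral_indicator measurableSet_ball, ← lintegral_indicator measurableSet_ball,
              ← lintegral_sub_right_eq_self ((Metric.ball (z - h) 1).indicator φ) h]
            refine lintegral_congr fun x => ?_
            simp only [indicator, Metric.mem_ball, dist_sub_right]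
          rw [h2]
          exact setLIntegral_ball_le_ulMass φ _
      _ = ulMass φ := by
          rw [lintegral_mul_const, lintegral_heatKernel_left _ ht, one_mul]
          exact (measurable_heatKernel measurable_id measurable_const
            measurable_const).ennreal_ofReal
  · exact ((measurable_heatKernel measurable_snd measurable_const
      measurable_const).ennreal_ofReal.mul
      (hφ.comp (measurable_fst.sub measurable_snd))).aemeasurable

/-- Moving y within a unit ball costs only a constant if the kernel is compared at the fixed time 2:
with r = ‖x - y‖, (r + 1)² ≤ 2r² + 2 gives ‖x - z‖²/8 ≤ r²/4 + 1/4, and r²/4 ≤ r²/(4t) as t ≤ 1. The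
singular factor t^{-N/2} is kept. -/
theorem heatKernel_le_of_dist_lt_one {x y z : EuclideanSpace ℝ (Fin N)} {t : ℝ}
    (ht : t ∈ Ioc (0 : ℝ) 1) (hyz : dist y z < 1) :
    heatKernel x y t ≤ 2 ^ ((N : ℝ) / 2) * Real.exp (1 / 4) * t ^ (-(N : ℝ) / 2) *
      heatKernel x z 2 := by
  have ht0 := ht.1
  unfold heatKernel
  have h1 : (4 * Real.pi * t) ^ (-(N : ℝ) / 2) =
      2 ^ ((N : ℝ) / 2) * t ^ (-(N : ℝ) / 2) * (4 * Real.pi * 2) ^ (-(N : ℝ) / 2) := by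
    rw [Real.mul_rpow (by positivity) ht0.le, Real.mul_rpow (by positivity : 0 ≤ 4 * Real.pi)
      (by norm_num : (0 : ℝ) ≤ 2), neg_div, Real.rpow_neg (by norm_num : (0 : ℝ) ≤ 2)]
    have : (2 : ℝ) ^ ((N : ℝ) / 2) ≠ 0 := by positivity
    field_simp
  have h2 : Real.exp (-‖x - y‖ ^ 2 / (4 * t)) ≤
      Real.exp (1 / 4) * Real.exp (-‖x - z‖ ^ 2 / (4 * 2)) := by
    rw [← Real.exp_add, Real.exp_le_exp]
    have h3 : ‖x - z‖ ≤ ‖x - y‖ + 1 := by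
      have := norm_sub_le_norm_sub_add_norm_sub x y z
      rw [dist_eq_norm] at hyz
      linarith
    have h4 : ‖x - y‖ ^ 2 / 4 ≤ ‖x - y‖ ^ 2 / (4 * t) :=
      div_le_div_of_nonneg_left (by positivity) (by positivity) (by linarith [ht.2])
    have h5 : -‖x - y‖ ^ 2 / (4 * t) = -(‖x - y‖ ^ 2 / (4 * t)) := by ring
    rw [h5]
    have h6 : ‖x - z‖ ^ 2 ≤ (‖x - y‖ + 1) ^ 2 := pow_le_pow_left₀ (norm_nonneg _) h3 2
    nlinarith [sq_nonneg (‖x - y‖ - 1)]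
  rw [h1]
  calc _ ≤ 2 ^ ((N : ℝ) / 2) * t ^ (-(N : ℝ) / 2) * (4 * Real.pi * 2) ^ (-(N : ℝ) / 2) *
        (Real.exp (1 / 4) * Real.exp (-‖x - z‖ ^ 2 / (4 * 2))) := by gcongr
    _ = _ := by ring

/-- The smoothing estimate from uniformly local mass to the supremum norm. -/
theorem exists_heatS_le_ulMass (N : ℕ) : ∃ C : ℝ, 0 < C ∧
    ∀ φ : EuclideanSpace ℝ (Fin N) → ℝ≥0∞, Measurable φ → ∀ t ∈ Ioc (0 : ℝ) 1, ∀ x,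
      heatS t φ x ≤ ENNReal.ofReal (C * t ^ (-(N : ℝ) / 2)) * ulMass φ := by
  set V := volume (Metric.ball (0 : EuclideanSpace ℝ (Fin N)) 1) with hV
  have hV0 : V ≠ 0 := (Metric.measure_ball_pos _ _ one_pos).ne'
  have hVtop : V ≠ ∞ := measure_ball_lt_top.ne
  set D : ℝ := 2 ^ ((N : ℝ) / 2) * Real.exp (1 / 4) with hD
  have hDpos : 0 < D := by positivity
  have hVr : 0 < V.toReal := ENNReal.toReal_pos hV0 hVtop
  refine ⟨V.toReal⁻¹ * D, by positivity, fun φ hφ t ht x => ?_⟩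
  have ht0 := ht.1
  -- The factor V is written as an integral over z in the unit ball about y. After exchanging
  -- integrals, the y-integral over the ball about z is bounded by `ulMass φ`, and the kernel at
  -- time 2 has mass 1 in z.
  have key : heatS t φ x * V ≤ ENNReal.ofReal (D * t ^ (-(N : ℝ) / 2)) * ulMass φ := by
    calc heatS t φ x * V
        = ∫⁻ y, ENNReal.ofReal (heatKernel x y t) * φ y * V := by
          rw [heatS, lintegral_mul_const' _ _ hVtop]
      _ = ∫⁻ y, ∫⁻ z, (Metric.ball y 1).indicator
            (fun _ => ENNReal.ofReal (heatKernel x y t) * φ y) z := by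
          refine lintegral_congr fun y => ?_
          rw [lintegral_indicator measurableSet_ball, setLIntegral_const,
            Measure.addHaar_ball_center]
      _ = ∫⁻ z, ∫⁻ y, (Metric.ball y 1).indicator
            (fun _ => ENNReal.ofReal (heatKernel x y t) * φ y) z := by
          refine lintegral_lintegral_swap ?_
          refine Measurable.aemeasurable ?_
          refine Measurable.ite (p := fun p : EuclideanSpace ℝ (Fin N) × EuclideanSpace ℝ (Fin N) =>
            p.2 ∈ Metric.ball p.1 1) ?_ ?_ measurable_const
          · exact measurableSet_lt (measurable_snd.dist measurable_fst) measurable_const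
          · exact (measurable_heatKernel measurable_const measurable_fst
              measurable_const).ennreal_ofReal.mul (hφ.comp measurable_fst)
      _ ≤ ∫⁻ z, ENNReal.ofReal (D * t ^ (-(N : ℝ) / 2)) *
            ENNReal.ofReal (heatKernel x z 2) * ulMass φ := by
          refine lintegral_mono fun z => ?_
          calc ∫⁻ y, (Metric.ball y 1).indicator
                  (fun _ => ENNReal.ofReal (heatKernel x y t) * φ y) z
              ≤ ∫⁻ y, (Metric.ball z 1).indicator
                  (fun y => ENNReal.ofReal (D * t ^ (-(N : ℝ) / 2)) *
                    ENNReal.ofReal (heatKernel x z 2) * φ y) y := by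
                refine lintegral_mono fun y => ?_
                by_cases h : dist y z < 1
                · rw [indicator_of_mem (by simpa [dist_comm] using h),
                    indicator_of_mem (by simpa using h),
                    ← ENNReal.ofReal_mul (by positivity)]
                  exact mul_le_mul_left
                    (ENNReal.ofReal_le_ofReal (heatKernel_le_of_dist_lt_one ht h)) _
                · rw [indicator_of_notMem (by simpa [dist_comm] using h)]
                  exact zero_le
            _ ≤ _ := by
                rw [lintegral_indicator measurableSet_ball, lintegral_const_mul' _ _
                  (ENNReal.mul_ne_top ENNReal.ofReal_ne_top ENNReal.ofReal_ne_top)]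
                gcongr
                exact setLIntegral_ball_le_ulMass φ z
      _ = _ := by
          have hm : Measurable fun z => ENNReal.ofReal (heatKernel x z 2) :=
            (measurable_heatKernel measurable_const measurable_id
              measurable_const).ennreal_ofReal
          rw [lintegral_mul_const _ (hm.const_mul _), lintegral_const_mul _ hm,
            lintegral_heatKernel_right x two_pos, mul_one]
  have h2 : ENNReal.ofReal (V.toReal⁻¹ * D * t ^ (-(N : ℝ) / 2)) =
      V⁻¹ * ENNReal.ofReal (D * t ^ (-(N : ℝ) / 2)) := by
    rw [mul_assoc, ENNReal.ofReal_mul (by positivity), ENNReal.ofReal_inv_of_pos hVr,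
      ENNReal.ofReal_toReal hVtop]
  rw [h2, mul_assoc, mul_comm V⁻¹, ← div_eq_mul_inv]
  exact (ENNReal.le_div_iff_mul_le (Or.inl hV0) (Or.inl hVtop)).2 key

end HeatSemigroup

/-! ### Monotone iteration below a supersolution. -/

section MonotoneIteration

variable {N : ℕ}

theorem duhamel_mono {f : ℝ → ℝ} {u₀ : EuclideanSpace ℝ (Fin N) → ℝ}
    {u v : ℝ → EuclideanSpace ℝ (Fin N) → ℝ} {t : ℝ} (x : EuclideanSpace ℝ (Fin N))
    (h : ∀ s ∈ Ioo 0 t, ∀ y, f (u s y) ≤ f (v s y)) :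
    duhamel f u₀ u t x ≤ duhamel f u₀ v t x := by
  unfold duhamel
  gcongr 1
  exact setLIntegral_mono' measurableSet_Ioo fun s hs =>
    heatS_mono (fun y => ENNReal.ofReal_le_ofReal (h s hs y)) _ _

theorem measurable_duhamel {f : ℝ → ℝ} (hf : Measurable f) {u₀ : EuclideanSpace ℝ (Fin N) → ℝ}
    (hu₀ : Measurable u₀) {u : ℝ → EuclideanSpace ℝ (Fin N) → ℝ}
    (hu : Measurable (Function.uncurry u)) :
    Measurable (Function.uncurry (duhamel f u₀ u)) := by
  refine Measurable.add (measurable_heatS measurable_fst measurable_snd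
    (hu₀.ennreal_ofReal.comp measurable_snd)) ?_
  -- An indicator replaces the p-dependent domain of integration, so that measurability of
  -- parametric integrals applies.
  have h1 : (fun p : ℝ × EuclideanSpace ℝ (Fin N) => ∫⁻ s in Ioo 0 p.1,
      heatS (p.1 - s) (fun y => ENNReal.ofReal (f (u s y))) p.2) =
      fun p => ∫⁻ s, {q : (ℝ × EuclideanSpace ℝ (Fin N)) × ℝ | q.2 ∈ Ioo 0 q.1.1}.indicator
        (fun q => heatS (q.1.1 - q.2) (fun y => ENNReal.ofReal (f (u q.2 y))) q.1.2) (p, s) := by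
    funext p
    rw [← lintegral_indicator measurableSet_Ioo]
    rfl
  rw [h1]
  refine Measurable.lintegral_prod_right' (Measurable.indicator ?_ ?_)
  · refine measurable_heatS ((measurable_fst.comp measurable_fst).sub measurable_snd)
      (measurable_snd.comp measurable_fst) ?_
    exact (hf.comp (hu.comp ((measurable_snd.comp measurable_fst).prodMk
      measurable_snd))).ennreal_ofReal
  · exact (measurableSet_lt measurable_const measurable_snd).inter
      (measurableSet_lt measurable_snd (measurable_fst.comp measurable_fst))

theorem measurable_heatS_comp {f : ℝ → ℝ} (hf : Measurable f)
    {u : ℝ → EuclideanSpace ℝ (Fin N) → ℝ} (hu : Measurable (Function.uncurry u)) (t : ℝ)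
    (x : EuclideanSpace ℝ (Fin N)) :
    Measurable fun s => heatS (t - s) (fun y => ENNReal.ofReal (f (u s y))) x :=
  measurable_heatS (measurable_const.sub measurable_id) measurable_const
    (hf.comp hu).ennreal_ofReal

/-- The Duhamel operator is continuous along increasing sequences. -/
theorem duhamel_eq_iSup {f : ℝ → ℝ} (hf : Continuous f) (hmono : Monotone f)
    {u₀ : EuclideanSpace ℝ (Fin N) → ℝ} {v : ℕ → ℝ → EuclideanSpace ℝ (Fin N) → ℝ}
    (hv : ∀ n, Measurable (Function.uncurry (v n)))
    {u : ℝ → EuclideanSpace ℝ (Fin N) → ℝ} {t : ℝ}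
    (hvmono : ∀ s ∈ Ioo 0 t, ∀ y, Monotone fun n => v n s y)
    (hvu : ∀ s ∈ Ioo 0 t, ∀ y, Tendsto (fun n => v n s y) atTop (𝓝 (u s y)))
    (x : EuclideanSpace ℝ (Fin N)) :
    duhamel f u₀ u t x = ⨆ n, duhamel f u₀ (v n) t x := by
  unfold duhamel
  rw [← ENNReal.add_iSup]
  congr 1
  have hmono' : ∀ s ∈ Ioo 0 t, Monotone fun n y => ENNReal.ofReal (f (v n s y)) :=
    fun s hs m n hmn y => ENNReal.ofReal_le_ofReal (hmono (hvmono s hs y hmn))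
  rw [← lintegral_iSup' (fun n => (measurable_heatS_comp hf.measurable (hv n) t x).aemeasurable)
    ((ae_restrict_iff' measurableSet_Ioo).2 (Eventually.of_forall fun s hs m n hmn =>
      heatS_mono (hmono' s hs hmn) _ _))]
  refine setLIntegral_congr_fun measurableSet_Ioo fun s hs => ?_
  rw [← heatS_iSup (φ := fun n y => ENNReal.ofReal (f (v n s y))) (fun n => (hf.measurable.comp ((hv n).comp
    measurable_prodMk_left)).ennreal_ofReal) (hmono' s hs)]
  congr 1
  funext y
  exact (iSup_eq_of_tendsto (fun m n hmn => hmono' s hs hmn y)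
    ((ENNReal.continuous_ofReal.comp hf).continuousAt.tendsto.comp (hvu s hs y))).symm

/-- Iterates of the Duhamel operator, started from zero. -/
noncomputable def duhamelIterate (f : ℝ → ℝ) (u₀ : EuclideanSpace ℝ (Fin N) → ℝ) :
    ℕ → ℝ → EuclideanSpace ℝ (Fin N) → ℝ
  | 0 => fun _ _ => 0
  | n + 1 => fun t x => (duhamel f u₀ (duhamelIterate f u₀ n) t x).toReal

/-- A supersolution of the integral equation dominates a solution. -/
theorem exists_solution_le_supersolution {f : ℝ → ℝ} (hf : Continuous f) (hmono : Monotone f)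
    {u₀ : EuclideanSpace ℝ (Fin N) → ℝ} (hu₀ : Measurable u₀)
    {T : ℝ} {w : ℝ → EuclideanSpace ℝ (Fin N) → ℝ} (hw0 : ∀ t ∈ Ioo 0 T, ∀ x, 0 ≤ w t x)
    (hw : ∀ t ∈ Ioo 0 T, ∀ x, duhamel f u₀ w t x ≤ ENNReal.ofReal (w t x)) :
    ∃ u : ℝ → EuclideanSpace ℝ (Fin N) → ℝ, Measurable (Function.uncurry u) ∧
      (∀ t x, 0 ≤ u t x) ∧ ∀ t ∈ Ioo 0 T, ∀ x, u t x ≤ w t x ∧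
        ENNReal.ofReal (u t x) = duhamel f u₀ u t x := by
  set v := duhamelIterate f u₀ with hv
  have hsub : ∀ {s t : ℝ}, t ∈ Ioo 0 T → s ∈ Ioo 0 t → s ∈ Ioo 0 T :=
    fun ht hs => ⟨hs.1, hs.2.trans ht.2⟩
  have hmeas : ∀ n, Measurable (Function.uncurry (v n)) := by
    intro n
    induction n with
    | zero => exact measurable_const
    | succ n ih => exact (measurable_duhamel hf.measurable hu₀ ih).ennreal_toReal
  have hnonneg : ∀ n t x, 0 ≤ v n t x := by
    intro n t x
    cases n with
    | zero => exact le_rfl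
    | succ n => exact ENNReal.toReal_nonneg
  have hle : ∀ n, ∀ t ∈ Ioo 0 T, ∀ x, v n t x ≤ w t x := by
    intro n
    induction n with
    | zero => exact hw0
    | succ n ih =>
      intro t ht x
      exact ENNReal.toReal_le_of_le_ofReal (hw0 t ht x)
        ((duhamel_mono x fun s hs y => hmono (ih s (hsub ht hs) y)).trans (hw t ht x))
  -- Finiteness lets the iterates, defined through `toReal`, be compared and converted back to
  -- `[0,∞]` without loss.
  have hfin : ∀ n, ∀ t ∈ Ioo 0 T, ∀ x, duhamel f u₀ (v n) t x ≠ ∞ := fun n t ht x =>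
    ne_top_of_le_ne_top ENNReal.ofReal_ne_top
      ((duhamel_mono x fun s hs y => hmono (hle n s (hsub ht hs) y)).trans (hw t ht x))
  have hsucc : ∀ n, ∀ t ∈ Ioo 0 T, ∀ x, v n t x ≤ v (n + 1) t x := by
    intro n
    induction n with
    | zero => exact fun t _ x => hnonneg _ _ _
    | succ n ih =>
      intro t ht x
      exact ENNReal.toReal_mono (hfin _ t ht x)
        (duhamel_mono x fun s hs y => hmono (ih s (hsub ht hs) y))
  have hvmono : ∀ t ∈ Ioo 0 T, ∀ x, Monotone fun n => v n t x :=
    fun t ht x => monotone_nat_of_le_succ fun n => hsucc n t ht x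
  have hbdd : ∀ t ∈ Ioo 0 T, ∀ x, BddAbove (range fun n => v n t x) := fun t ht x =>
    ⟨w t x, by rintro _ ⟨n, rfl⟩; exact hle n t ht x⟩
  have hlim : ∀ t ∈ Ioo 0 T, ∀ x, Tendsto (fun n => v n t x) atTop (𝓝 (⨆ n, v n t x)) :=
    fun t ht x => tendsto_atTop_ciSup (hvmono t ht x) (hbdd t ht x)
  refine ⟨fun t x => ⨆ n, v n t x, Measurable.iSup hmeas,
    fun t x => Real.iSup_nonneg fun n => hnonneg n t x, fun t ht x =>
      ⟨ciSup_le fun n => hle n t ht x, ?_⟩⟩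
  rw [duhamel_eq_iSup hf hmono hmeas (fun s hs => hvmono s (hsub ht hs))
    (fun s hs => hlim s (hsub ht hs))]
  have h1 : Tendsto (fun n => ENNReal.ofReal (v (n + 1) t x)) atTop
      (𝓝 (ENNReal.ofReal (⨆ n, v n t x))) :=
    (ENNReal.continuous_ofReal.tendsto _).comp ((hlim t ht x).comp (tendsto_add_atTop_nat 1))
  have h2 : ∀ n, ENNReal.ofReal (v (n + 1) t x) = duhamel f u₀ (v n) t x := fun n =>
    ENNReal.ofReal_toReal (hfin n t ht x)
  simp_rw [h2] at h1
  refine (iSup_eq_of_tendsto (fun m n hmn => ?_) h1).symm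
  exact duhamel_mono x fun s hs y => hmono (hvmono s (hsub ht hs) y hmn)

end MonotoneIteration

/-! ### The inverse of J, the tail integral and the mean value theorem. -/

section Transform

/-- A continuous strictly increasing unbounded function on `[R,∞)` has an inverse that extends to a
monotone function on `ℝ` with values in `[R,∞)`. -/
theorem exists_monotone_inverse {J : ℝ → ℝ} {R : ℝ} (hc : ContinuousOn J (Ici R))
    (hm : StrictMonoOn J (Ici R)) (ht : Tendsto J atTop atTop) :
    ∃ I : ℝ → ℝ, Monotone I ∧ (∀ s, R ≤ I s) ∧ (∀ s, J R ≤ s → J (I s) = s) ∧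
      ∀ a, R ≤ a → I (J a) = a := by
  -- Clamping s at `J R` makes the inverse total and keeps it monotone.
  have hex : ∀ s, ∃ a, R ≤ a ∧ J a = max s (J R) := by
    intro s
    obtain ⟨b, hb1, hb2⟩ := ((ht.eventually_ge_atTop (max s (J R))).and
      (eventually_ge_atTop R)).exists
    obtain ⟨a, ha, hJa⟩ := intermediate_value_Icc hb2 (hc.mono Icc_subset_Ici_self)
      ⟨le_max_right s (J R), hb1⟩
    exact ⟨a, ha.1, hJa⟩
  choose I hI1 hI2 using hex
  refine ⟨I, fun s s' hs => ?_, hI1, fun s hs => by rw [hI2, max_eq_left hs], fun a ha => ?_⟩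
  · rw [← hm.le_iff_le (hI1 s) (hI1 s'), hI2, hI2]
    exact max_le_max_right _ hs
  · refine hm.injOn (hI1 _) ha ?_
    rw [hI2, max_eq_left (hm.monotoneOn self_mem_Ici ha ha)]

variable {J : ℝ → ℝ}

theorem ConditionJ.hasDerivAt (hJ : ConditionJ J) {τ : ℝ} (hτ : 0 < τ) :
    HasDerivAt J (derivWithin J (Ici 0) τ) τ :=
  (((hJ.contDiffOn.differentiableOn (by norm_num)) τ hτ.le).hasDerivWithinAt).hasDerivAt
    (Ici_mem_nhds hτ)

theorem ConditionJ.strictMonoOn (hJ : ConditionJ J) : StrictMonoOn J (Ici 0) := by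
  refine strictMonoOn_of_deriv_pos (convex_Ici 0) hJ.contDiffOn.continuousOn fun τ hτ => ?_
  rw [interior_Ici] at hτ
  rw [(hJ.hasDerivAt hτ).deriv]
  exact hJ.deriv_pos τ hτ

/-- The mean value theorem for `J`. -/
theorem ConditionJ.exists_sub_eq (hJ : ConditionJ J) {a b : ℝ} (ha : 0 < a) (hab : a < b) :
    ∃ c ∈ Ioo a b, J b - J a = derivWithin J (Ici 0) c * (b - a) := by
  obtain ⟨c, hc, h⟩ := exists_hasDerivAt_eq_slope J (derivWithin J (Ici 0)) hab
    (hJ.contDiffOn.continuousOn.mono fun x hx => ha.le.trans hx.1)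
    (fun x hx => hJ.hasDerivAt (ha.trans hx.1))
  refine ⟨c, hc, ?_⟩
  rw [h, div_mul_cancel₀ _ (sub_pos.2 hab).ne']

/-- Tangent lines lie below the graph of `J` where `J'` is nondecreasing. -/
theorem ConditionJ.tangent_le (hJ : ConditionJ J) {R : ℝ} (hR : 0 < R)
    (hmono : MonotoneOn (derivWithin J (Ici 0)) (Ici R)) {a b : ℝ} (ha : R ≤ a) (hb : R ≤ b) :
    J b + derivWithin J (Ici 0) b * (a - b) ≤ J a := by
  rcases lt_trichotomy a b with h | h | h
  · obtain ⟨c, hc, hc'⟩ := hJ.exists_sub_eq (hR.trans_le ha) h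
    have := hmono (ha.trans hc.1.le) hb hc.2.le
    nlinarith [mul_le_mul_of_nonneg_right this (sub_pos.2 h).le]
  · simp [h]
  · obtain ⟨c, hc, hc'⟩ := hJ.exists_sub_eq (hR.trans_le hb) h
    have := hmono hb (hb.trans hc.1.le) hc.1.le
    nlinarith [mul_le_mul_of_nonneg_right this (sub_pos.2 h).le]

theorem fTilde_mono (f J : ℝ → ℝ) (θ : ℝ) {ξ ξ' u u' : ℝ} (h : ξ' ≤ ξ) (hu : u ≤ u') :
    fTilde f J θ ξ u ≤ fTilde f J θ ξ' u' :=
  biSup_mono fun _ hτ => ⟨h.trans hτ.1, hτ.2.trans hu⟩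

theorem JTilde_mono (J : ℝ → ℝ) (θ : ℝ) {ξ ξ' u u' : ℝ} (h : ξ' ≤ ξ) (hu : u ≤ u') :
    JTilde J θ ξ u ≤ JTilde J θ ξ' u' :=
  biSup_mono fun _ hτ => ⟨h.trans hτ.1, hτ.2.trans hu⟩

/-- Permits replacing ξ by the larger R, beyond which J is also convex. -/
theorem tailQuantity_anti (N : ℕ) (f J : ℝ → ℝ) (θ η : ℝ) {ξ ξ' : ℝ} (h : ξ' ≤ ξ) :
    tailQuantity N f J θ ξ η ≤ tailQuantity N f J θ ξ' η := by
  unfold tailQuantity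
  gcongr
  · exact JTilde_mono J θ h le_rfl
  · exact fTilde_mono f J θ h le_rfl

theorem ofReal_le_fTilde_mul (f : ℝ → ℝ) {θ R τ : ℝ} (hJ : 0 < J τ) (hτ : R ≤ τ) :
    ENNReal.ofReal (f τ) ≤ fTilde f J θ R τ * ENNReal.ofReal (J τ ^ θ) := by
  rw [← ENNReal.div_le_iff (ENNReal.ofReal_pos.2 (by positivity)).ne' ENNReal.ofReal_ne_top]
  exact le_biSup (fun τ => ENNReal.ofReal (f τ) / ENNReal.ofReal (J τ ^ θ))
    (show τ ∈ Icc R τ from ⟨hτ, le_rfl⟩)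

/-- The mean value theorem for `J`, with `J'` estimated by `J̃`. -/
theorem ConditionJ.ofReal_sub_le (hJ : ConditionJ J) {θ R a b : ℝ} (hθ : θ ≤ 1) (hR : 0 < R)
    (ha : R ≤ a) (hab : a < b) :
    ENNReal.ofReal (J b - J a) ≤
      JTilde J θ R b * ENNReal.ofReal (J b ^ (1 - θ)) * ENNReal.ofReal (b - a) := by
  obtain ⟨c, hc, h⟩ := hJ.exists_sub_eq (hR.trans_le ha) hab
  have hc0 : 0 < c := (hR.trans_le ha).trans hc.1
  have hJc := hJ.pos c hc0
  rw [h, ENNReal.ofReal_mul (hJ.deriv_pos c hc0).le]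
  gcongr
  calc ENNReal.ofReal (derivWithin J (Ici 0) c)
      ≤ JTilde J θ R b * ENNReal.ofReal (J c ^ (1 - θ)) := by
        rw [← ENNReal.div_le_iff (ENNReal.ofReal_pos.2 (by positivity)).ne' ENNReal.ofReal_ne_top]
        exact le_biSup (fun τ => ENNReal.ofReal (derivWithin J (Ici 0) τ) /
          ENNReal.ofReal (J τ ^ (1 - θ))) (show c ∈ Icc R b from ⟨ha.trans hc.1.le, hc.2.le⟩)
    _ ≤ _ := by
        gcongr
        exact hJ.strictMonoOn.monotoneOn hc0.le (hc0.trans hc.2).le hc.2.le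

/-- The substitution `J(τ) = κ s^{-N/2}`. -/
theorem ConditionJ.lintegral_inverse_le (hJ : ConditionJ J) {N : ℕ} (hN : 1 ≤ N) {R κ t : ℝ}
    (hR : 0 < R) (hκ : 0 < κ) {I : ℝ → ℝ} (hIR : ∀ s, R ≤ I s)
    (hI : ∀ s, J R ≤ s → J (I s) = s) (hI' : ∀ a, R ≤ a → I (J a) = a)
    (ht : J R ≤ κ * t ^ (-(N : ℝ) / 2)) (F : ℝ → ℝ≥0∞) :
    ∫⁻ s in Ioo 0 t, F (I (κ * s ^ (-(N : ℝ) / 2))) ≤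
      ENNReal.ofReal (2 / N * κ ^ (2 / (N : ℝ))) *
        ∫⁻ τ in Ioi (I (κ * t ^ (-(N : ℝ) / 2))), F τ * ENNReal.ofReal (derivWithin J (Ici 0) τ) /
          ENNReal.ofReal (J τ ^ (1 + 2 / (N : ℝ))) := by
  have hN0 : (0 : ℝ) < N := by exact_mod_cast hN
  set η := I (κ * t ^ (-(N : ℝ) / 2)) with hη
  set p : ℝ := 2 / (N : ℝ) with hp
  have hp0 : 0 < p := by positivity
  -- The time s at which κ s^{-N/2} = J τ.
  set g : ℝ → ℝ := fun τ => κ ^ p * J τ ^ (-p) with hg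
  have hpos : ∀ τ ∈ Ioi η, 0 < τ := fun τ hτ => hR.trans_le ((hIR _).trans (mem_Ioi.1 hτ).le)
  have hgdef : ∀ τ ∈ Ioi η, κ * g τ ^ (-(N : ℝ) / 2) = J τ := by
    intro τ hτ
    have h0 := hJ.pos τ (hpos τ hτ)
    simp only [hg]
    rw [Real.mul_rpow (by positivity) (by positivity), ← Real.rpow_mul hκ.le, ← Real.rpow_mul h0.le]
    have e1 : p * (-(N : ℝ) / 2) = -1 := by rw [hp]; field_simp
    have e2 : -p * (-(N : ℝ) / 2) = 1 := by rw [hp]; field_simp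
    rw [e1, e2, Real.rpow_neg_one, Real.rpow_one, mul_inv_cancel_left₀ hκ.ne']
  have hinj : InjOn g (Ioi η) := by
    intro a ha b hb hab
    refine hJ.strictMonoOn.injOn (hpos a ha).le (hpos b hb).le ?_
    rw [← hgdef a ha, ← hgdef b hb, hab]
  have hderiv : ∀ τ ∈ Ioi η, HasDerivWithinAt g
      (κ ^ p * (derivWithin J (Ici 0) τ * -p * J τ ^ (-p - 1))) (Ioi η) τ := fun τ hτ =>
    (((hJ.hasDerivAt (hpos τ hτ)).rpow_const (Or.inl (hJ.pos τ (hpos τ hτ)).ne')).const_mul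
      _).hasDerivWithinAt
  -- Only this inclusion is needed, as the claim is an upper bound.
  have himage : Ioo 0 t ⊆ g '' Ioi η := by
    intro s hs
    have h1 : κ * t ^ (-(N : ℝ) / 2) < κ * s ^ (-(N : ℝ) / 2) :=
      mul_lt_mul_of_pos_left (Real.rpow_lt_rpow_of_neg hs.1 hs.2
        (by rw [neg_div]; exact neg_lt_zero.2 (by positivity))) hκ
    have h2 : J (I (κ * s ^ (-(N : ℝ) / 2))) = κ * s ^ (-(N : ℝ) / 2) := hI _ (ht.trans h1.le)
    refine ⟨I (κ * s ^ (-(N : ℝ) / 2)), ?_, ?_⟩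
    · rw [mem_Ioi, ← hJ.strictMonoOn.lt_iff_lt (hR.le.trans (hIR _)) (hR.le.trans (hIR _)), h2, hI _ ht]
      exact h1
    · simp only [hg]
      rw [h2, Real.mul_rpow hκ.le (Real.rpow_nonneg hs.1.le _), ← Real.rpow_mul hs.1.le]
      have e2 : -(N : ℝ) / 2 * -p = 1 := by rw [hp]; field_simp
      rw [e2, Real.rpow_one, ← mul_assoc, ← Real.rpow_add hκ, add_neg_cancel, Real.rpow_zero,
        one_mul]
  calc ∫⁻ s in Ioo 0 t, F (I (κ * s ^ (-(N : ℝ) / 2)))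
      ≤ ∫⁻ s in g '' Ioi η, F (I (κ * s ^ (-(N : ℝ) / 2))) := lintegral_mono_set himage
    _ = ∫⁻ τ in Ioi η, ENNReal.ofReal
          |κ ^ p * (derivWithin J (Ici 0) τ * -p * J τ ^ (-p - 1))| *
            F (I (κ * g τ ^ (-(N : ℝ) / 2))) :=
        lintegral_image_eq_lintegral_abs_deriv_mul measurableSet_Ioi hderiv hinj _
    _ = ∫⁻ τ in Ioi η, ENNReal.ofReal (p * κ ^ p) *
          (F τ * ENNReal.ofReal (derivWithin J (Ici 0) τ) / ENNReal.ofReal (J τ ^ (1 + p))) := by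
        refine setLIntegral_congr_fun measurableSet_Ioi fun τ hτ => ?_
        have hτ0 := hpos τ hτ
        have h0 := hJ.pos τ hτ0
        have h1 := hJ.deriv_pos τ hτ0
        rw [hgdef τ hτ, hI' τ ((hIR _).trans (mem_Ioi.1 hτ).le)]
        have h2 : |κ ^ p * (derivWithin J (Ici 0) τ * -p * J τ ^ (-p - 1))| =
            (p * κ ^ p) * (derivWithin J (Ici 0) τ * (J τ ^ (1 + p))⁻¹) := by
          rw [← Real.rpow_neg h0.le, show -(1 + p) = -p - 1 by ring,
            show κ ^ p * (derivWithin J (Ici 0) τ * -p * J τ ^ (-p - 1)) =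
              -((p * κ ^ p) * (derivWithin J (Ici 0) τ * J τ ^ (-p - 1))) by ring, abs_neg,
            abs_of_pos (by positivity)]
        rw [h2, ENNReal.ofReal_mul (by positivity), ENNReal.ofReal_mul h1.le,
          ENNReal.ofReal_inv_of_pos (by positivity), div_eq_mul_inv]
        ring
    _ = _ := lintegral_const_mul' _ _ ENNReal.ofReal_ne_top

/-- The gain of `J⁻¹(2W)` over `J⁻¹(W)` absorbs the source term. -/
theorem ConditionJ.inverse_add_le (hJ : ConditionJ J) {θ R W η : ℝ} (hθ : θ ∈ Ioc (0 : ℝ) 1)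
    (hR : 0 < R) {I : ℝ → ℝ} (hImono : Monotone I) (hIR : ∀ s, R ≤ I s)
    (hI : ∀ s, J R ≤ s → J (I s) = s) (hW : J R ≤ W) (hη : I (2 * W) ≤ η) {A : ℝ≥0∞}
    (hA : A * JTilde J θ R η ≤ 1 / 2) :
    ENNReal.ofReal (I W) + A * ENNReal.ofReal (2 * W) ^ θ ≤ ENNReal.ofReal (I (2 * W)) := by
  have hW0 : 0 < W := (hJ.pos R hR).trans_le hW
  have hJ1 := hI W hW
  have hJ2 := hI (2 * W) (by linarith)
  have hlt : I W < I (2 * W) := by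
    refine lt_of_le_of_ne (hImono (by linarith)) fun h => ?_
    rw [h, hJ2] at hJ1
    linarith
  have h1 := hJ.ofReal_sub_le hθ.2 hR (hIR W) hlt
  rw [hJ1, hJ2, show 2 * W - W = W by ring] at h1
  set d := ENNReal.ofReal (I (2 * W) - I W) with hd
  have hpos : ENNReal.ofReal (2 * W) ≠ 0 := (ENNReal.ofReal_pos.2 (by positivity)).ne'
  -- The mean value bound W ≤ J̃ (2W)^{1-θ} d, doubled and divided by (2W)^{1-θ}.
  have h2 : ENNReal.ofReal (2 * W) ^ θ ≤ 2 * (JTilde J θ R η * d) := by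
    have hne : ENNReal.ofReal (2 * W) ^ (1 - θ) ≠ 0 :=
      (ENNReal.rpow_pos (ENNReal.ofReal_pos.2 (by positivity)) ENNReal.ofReal_ne_top).ne'
    have hne' : ENNReal.ofReal (2 * W) ^ (1 - θ) ≠ ∞ :=
      ENNReal.rpow_ne_top_of_nonneg (sub_nonneg.2 hθ.2) ENNReal.ofReal_ne_top
    rw [← ENNReal.mul_le_mul_iff_left hne hne', ← ENNReal.rpow_add _ _ hpos ENNReal.ofReal_ne_top,
      add_sub_cancel, ENNReal.rpow_one, ENNReal.ofReal_mul two_pos.le, ENNReal.ofReal_ofNat]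
    rw [← ENNReal.ofReal_rpow_of_pos (by positivity)] at h1
    calc 2 * ENNReal.ofReal W
        ≤ 2 * (JTilde J θ R η * ENNReal.ofReal (2 * W) ^ (1 - θ) * d) := by
          gcongr
          refine h1.trans ?_
          gcongr
          exact JTilde_mono J θ le_rfl hη
      _ = _ := by
          rw [ENNReal.ofReal_mul two_pos.le, ENNReal.ofReal_ofNat]
          ring
  calc ENNReal.ofReal (I W) + A * ENNReal.ofReal (2 * W) ^ θ
      ≤ ENNReal.ofReal (I W) + A * (2 * (JTilde J θ R η * d)) := by gcongr
    _ = ENNReal.ofReal (I W) + 2 * (A * JTilde J θ R η) * d := by ring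
    _ ≤ ENNReal.ofReal (I W) + 2 * (1 / 2) * d := by gcongr
    _ = ENNReal.ofReal (I W) + d := by
        rw [one_div, ENNReal.mul_inv_cancel two_ne_zero ENNReal.ofNat_ne_top, one_mul]
    _ = ENNReal.ofReal (I (2 * W)) := by
        rw [hd, ← ENNReal.ofReal_add (hR.le.trans (hIR W)) (sub_pos.2 hlt).le, add_sub_cancel]

end Transform

/-! ### Verification of the supersolution. -/

section Supersolution

variable {N : ℕ} {J : ℝ → ℝ}

/-- Jensen's inequality for the heat semigroup and `J`, on functions with values in `[R,∞)`. -/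
theorem ConditionJ.heatS_le_inverse (hJ : ConditionJ J) {R : ℝ} (hR : 0 < R)
    (hmono : MonotoneOn (derivWithin J (Ici 0)) (Ici R)) {m : EuclideanSpace ℝ (Fin N) → ℝ}
    (hm : Measurable m) (hmR : ∀ y, R ≤ m y) {t W : ℝ} (ht : 0 < t) {I : ℝ → ℝ}
    (hIR : ∀ s, R ≤ I s) (hI : ∀ s, J R ≤ s → J (I s) = s) (hWR : J R ≤ W)
    (x : EuclideanSpace ℝ (Fin N)) (hW : heatS t (fun y => ENNReal.ofReal (J (m y))) x =
      ENNReal.ofReal W) :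
    heatS t (fun y => ENNReal.ofReal (m y)) x ≤ ENNReal.ofReal (I W) := by
  have hJW := hI W hWR
  have hb0 : 0 < I W := hR.trans_le (hIR W)
  have hd := hJ.deriv_pos _ hb0
  have hW0 : 0 ≤ W := (hJ.pos R hR).le.trans hWR
  set d := derivWithin J (Ici 0) (I W)
  -- The tangent line of J at I(W), rearranged so that all terms are nonnegative. Applying the
  -- semigroup puts W on both sides, where it cancels because it is finite.
  have h1 : ∀ y, ENNReal.ofReal W + ENNReal.ofReal d * ENNReal.ofReal (m y) ≤
      ENNReal.ofReal d * ENNReal.ofReal (I W) + ENNReal.ofReal (J (m y)) := by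
    intro y
    have hmy : 0 < m y := hR.trans_le (hmR y)
    rw [← ENNReal.ofReal_mul hd.le, ← ENNReal.ofReal_mul hd.le,
      ← ENNReal.ofReal_add hW0 (by positivity),
      ← ENNReal.ofReal_add (by positivity) (hJ.pos _ hmy).le]
    refine ENNReal.ofReal_le_ofReal ?_
    have := hJ.tangent_le hR hmono (hmR y) (hIR W)
    rw [hJW] at this
    linarith
  have h2 := heatS_mono h1 t x
  rw [heatS_add measurable_const, heatS_add measurable_const, heatS_const _ ht, heatS_const _ ht,
    heatS_const_mul _ hm.ennreal_ofReal, hW, add_comm,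
    ENNReal.add_le_add_iff_right ENNReal.ofReal_ne_top] at h2
  exact (ENNReal.mul_le_mul_iff_right (ENNReal.ofReal_pos.2 hd).ne' ENNReal.ofReal_ne_top).1 h2

theorem ConditionJ.ofReal_le_heatS (hJ : ConditionJ J) {R : ℝ} (hR : 0 ≤ R)
    {m : EuclideanSpace ℝ (Fin N) → ℝ} (hmR : ∀ y, R ≤ m y) {t : ℝ} (ht : 0 < t)
    (x : EuclideanSpace ℝ (Fin N)) :
    ENNReal.ofReal (J R) ≤ heatS t (fun y => ENNReal.ofReal (J (m y))) x := by
  rw [← heatS_const (ENNReal.ofReal (J R)) ht x]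
  exact heatS_mono (fun y => ENNReal.ofReal_le_ofReal
    (hJ.strictMonoOn.monotoneOn hR (hR.trans (hmR y)) (hmR y))) _ _

/-- `J⁻¹(2 S(t) J(m))` is a supersolution. -/
theorem ConditionJ.duhamel_le (hJ : ConditionJ J) (hN : 1 ≤ N) {R : ℝ} (hR : 0 < R)
    (hmono : MonotoneOn (derivWithin J (Ici 0)) (Ici R)) {m : EuclideanSpace ℝ (Fin N) → ℝ}
    (hm : Measurable m) (hJm : Measurable fun y => J (m y)) (hmR : ∀ y, R ≤ m y) {I : ℝ → ℝ}
    (hImono : Monotone I) (hIR : ∀ s, R ≤ I s) (hI : ∀ s, J R ≤ s → J (I s) = s)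
    (hI' : ∀ a, R ≤ a → I (J a) = a) {f : ℝ → ℝ} {θ : ℝ} (hθ : θ ∈ Ioc (0 : ℝ) 1)
    {u₀ : EuclideanSpace ℝ (Fin N) → ℝ} (hu₀ : ∀ y, u₀ y ≤ m y) {κ T : ℝ} (hκ : 0 < κ)
    (hw : ∀ s ∈ Ioo 0 T, ∀ y, 2 * heatS s (fun y => ENNReal.ofReal (J (m y))) y ≤
      ENNReal.ofReal (κ * s ^ (-(N : ℝ) / 2)))
    (htail : ∀ t ∈ Ioo 0 T, ENNReal.ofReal (2 / N * κ ^ (2 / (N : ℝ))) *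
      tailQuantity N f J θ R (I (κ * t ^ (-(N : ℝ) / 2))) ≤ 1 / 2)
    {t : ℝ} (ht : t ∈ Ioo 0 T) (x : EuclideanSpace ℝ (Fin N)) :
    duhamel f u₀ (fun s y => I (2 * (heatS s (fun y => ENNReal.ofReal (J (m y))) y).toReal)) t x ≤
      ENNReal.ofReal (I (2 * (heatS t (fun y => ENNReal.ofReal (J (m y))) x).toReal)) := by
  set Φ : EuclideanSpace ℝ (Fin N) → ℝ≥0∞ := fun y => ENNReal.ofReal (J (m y)) with hΦ
  have hΦm : Measurable Φ := hJm.ennreal_ofReal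
  have hfin : ∀ s ∈ Ioo 0 T, ∀ y, heatS s Φ y ≠ ∞ := fun s hs y h => by
    have := hw s hs y
    rw [h, ENNReal.mul_top two_ne_zero] at this
    exact ENNReal.ofReal_ne_top (top_le_iff.1 this)
  have hlow : ∀ s ∈ Ioo 0 T, ∀ y, J R ≤ (heatS s Φ y).toReal := fun s hs y =>
    (ENNReal.ofReal_le_iff_le_toReal (hfin s hs y)).1 (hJ.ofReal_le_heatS hR.le hmR hs.1 y)
  have hup : ∀ s ∈ Ioo 0 T, ∀ y, 2 * (heatS s Φ y).toReal ≤ κ * s ^ (-(N : ℝ) / 2) :=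
    fun s hs y => by
      have := hs.1
      have h := ENNReal.toReal_mono ENNReal.ofReal_ne_top (hw s hs y)
      rwa [ENNReal.toReal_mul, ENNReal.toReal_ofReal (by positivity), ENNReal.toReal_ofNat] at h
  have hJR := hJ.pos R hR
  set A : ℝ≥0∞ := ∫⁻ s in Ioo 0 t, fTilde f J θ R (I (κ * s ^ (-(N : ℝ) / 2))) with hA
  -- The tail is taken at η = I(κ t^{-N/2}), which dominates I(2W) for every x at time t.
  have hAJ : A * JTilde J θ R (I (κ * t ^ (-(N : ℝ) / 2))) ≤ 1 / 2 := by
    refine le_trans ?_ (htail t ht)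
    have h1 := hJ.lintegral_inverse_le hN hR hκ hIR hI hI'
      (by linarith [hlow t ht x, hup t ht x] : J R ≤ κ * t ^ (-(N : ℝ) / 2)) (fTilde f J θ R)
    calc _ ≤ _ := mul_le_mul_left h1 _
      _ = _ := by unfold tailQuantity; ring
  refine le_trans ?_ (hJ.inverse_add_le hθ hR hImono hIR hI (hlow t ht x)
    (hImono (hup t ht x)) hAJ)
  unfold duhamel
  have hW : heatS t Φ x = ENNReal.ofReal (heatS t Φ x).toReal :=
    (ENNReal.ofReal_toReal (hfin t ht x)).symm
  refine add_le_add ?_ ?_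
  · exact (heatS_mono (fun y => ENNReal.ofReal_le_ofReal (hu₀ y)) _ _).trans
      (hJ.heatS_le_inverse hR hmono hm hmR ht.1 hIR hI (hlow t ht x) x hW)
  · have h2W : ∀ s ∈ Ioo 0 T, ∀ y, ENNReal.ofReal (2 * (heatS s Φ y).toReal) = 2 * heatS s Φ y :=
      fun s hs y => by
        rw [ENNReal.ofReal_mul two_pos.le, ENNReal.ofReal_toReal (hfin s hs y),
          ENNReal.ofReal_ofNat]
    rw [hA, ← lintegral_mul_const' _ _
      (ENNReal.rpow_ne_top_of_nonneg hθ.1.le ENNReal.ofReal_ne_top)]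
    refine setLIntegral_mono' measurableSet_Ioo fun s hs => ?_
    have hsT : s ∈ Ioo 0 T := ⟨hs.1, hs.2.trans ht.2⟩
    set c := fTilde f J θ R (I (κ * s ^ (-(N : ℝ) / 2))) with hc
    have hcm : Measurable fun y => (2 * heatS s Φ y) ^ θ :=
      ((measurable_heatS_right hΦm s).const_mul 2).pow_const θ
    calc heatS (t - s) (fun y => ENNReal.ofReal (f (I (2 * (heatS s Φ y).toReal)))) x
        ≤ heatS (t - s) (fun y => c * (2 * heatS s Φ y) ^ θ) x := by
          refine heatS_mono (fun y => ?_) _ _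
          have hJI : J (I (2 * (heatS s Φ y).toReal)) = 2 * (heatS s Φ y).toReal :=
            hI _ (by linarith [hlow s hsT y])
          have hpos : 0 < 2 * (heatS s Φ y).toReal := by linarith [hlow s hsT y]
          refine (ofReal_le_fTilde_mul (J := J) f (θ := θ) (R := R) (by rw [hJI]; exact hpos)
            (hIR _)).trans ?_
          rw [hJI, ← ENNReal.ofReal_rpow_of_pos hpos, h2W s hsT y]
          gcongr
          exact fTilde_mono f J θ le_rfl (hImono (hup s hsT y))
      _ = c * heatS (t - s) (fun y => (2 * heatS s Φ y) ^ θ) x := heatS_const_mul _ hcm _ _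
      _ ≤ c * heatS (t - s) (fun y => 2 * heatS s Φ y) x ^ θ := by
          gcongr
          exact heatS_rpow_le ((measurable_heatS_right hΦm s).const_mul 2) hθ (sub_pos.2 hs.2) x
      _ = c * ENNReal.ofReal (2 * (heatS t Φ x).toReal) ^ θ := by
          rw [heatS_const_mul _ (measurable_heatS_right hΦm s), heatS_heatS hΦm (sub_pos.2 hs.2) hs.1,
            sub_add_cancel, h2W t ht x]

end Supersolution

/-! ### Decay of the linear flow and existence of solutions. -/

section Existence

variable {N : ℕ} {J : ℝ → ℝ}

theorem ConditionJ.nonneg (hJ : ConditionJ J) {τ : ℝ} (hτ : 0 ≤ τ) : 0 ≤ J τ := by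
  rcases hτ.eq_or_lt with rfl | h
  · exact ge_of_tendsto ((hJ.contDiffOn.continuousOn 0 self_mem_Ici).mono_left
      (nhdsWithin_mono _ Ioi_subset_Ici_self))
      (eventually_mem_nhdsWithin.mono fun τ hτ => (hJ.pos τ hτ).le)
  · exact (hJ.pos τ h).le

theorem ConditionJ.measurable_comp_max (hJ : ConditionJ J) {R : ℝ} (hR : 0 ≤ R) {α : Type*}
    [MeasurableSpace α] {u : α → ℝ} (hu : Measurable u) :
    Measurable fun a => J (max (u a) R) := by
  have : Continuous fun τ => J (max τ R) := hJ.contDiffOn.continuousOn.comp_continuous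
    (continuous_id.max continuous_const) fun τ => hR.trans (le_max_right _ _)
  exact this.measurable.comp hu

/-- `κ t^{-N/2}` dominates constants for small times. -/
theorem exists_forall_le_mul_rpow {N : ℕ} (hN : 1 ≤ N) {κ : ℝ} (hκ : 0 < κ) (B : ℝ) :
    ∃ T ∈ Ioc (0 : ℝ) 1, ∀ t ∈ Ioo 0 T, B ≤ κ * t ^ (-(N : ℝ) / 2) := by
  have hN0 : (0 : ℝ) < N := by exact_mod_cast hN
  have h1 : Tendsto (fun t : ℝ => κ * t ^ (-(N : ℝ) / 2)) (𝓝[>] 0) atTop :=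
    (tendsto_rpow_neg_nhdsGT_zero (by linarith)).const_mul_atTop hκ
  obtain ⟨T, hT, hT'⟩ := mem_nhdsGT_iff_exists_Ioo_subset.1 (h1.eventually_ge_atTop B)
  exact ⟨min T 1, ⟨lt_min hT one_pos, min_le_right _ _⟩,
    fun t ht => hT' ⟨ht.1, ht.2.trans_le (min_le_left _ _)⟩⟩

/-- Existence of a solution once the decay of `S(t) J(u₀)` is fast enough for the source term. -/
theorem ConditionJ.exists_solution_of_decay (hJ : ConditionJ J) (hN : 1 ≤ N)
    {u₀ : EuclideanSpace ℝ (Fin N) → ℝ} (hu₀m : Measurable u₀)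
    {f : ℝ → ℝ} (hf : Continuous f) (hfmono : Monotone f) {θ : ℝ} (hθ : θ ∈ Ioc (0 : ℝ) 1) {ξ : ℝ}
    (hul : ulMass (fun x => ENNReal.ofReal (J (u₀ x))) < ∞) {κ M : ℝ} (hκ : 0 < κ)
    (hdecay : ∀ t ∈ Ioc (0 : ℝ) 1, ∀ x, heatS t (fun y => ENNReal.ofReal (J (u₀ y))) x ≤
      ENNReal.ofReal (κ * t ^ (-(N : ℝ) / 2) + M))
    (htail : ∀ᶠ η in atTop, ENNReal.ofReal (2 / N * (4 * κ) ^ (2 / (N : ℝ))) *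
      tailQuantity N f J θ ξ η ≤ 1 / 2) :
    ∃ (T : ℝ) (u : ℝ → EuclideanSpace ℝ (Fin N) → ℝ), 0 < T ∧ (∀ t x, 0 ≤ u t x) ∧
      IsNonnegSolution f u₀ T u ∧ ∃ C₀ : ℝ, 0 < C₀ ∧ ∀ t ∈ Ioo 0 T,
        MemUL 1 (fun x => J (u t x)) ∧ ulNorm 1 (fun x => J (u t x)) ≤ ENNReal.ofReal C₀ := by
  obtain ⟨C, hC0, hC⟩ := hJ.deriv_mono
  -- R lies above the convexity threshold of J, above ξ, and away from 0.
  set R : ℝ := max C (max ξ 1) with hRdef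
  have hR : 0 < R := one_pos.trans_le ((le_max_right _ _).trans (le_max_right _ _))
  have hξR : ξ ≤ R := (le_max_left _ _).trans (le_max_right _ _)
  have hmono : MonotoneOn (derivWithin J (Ici 0)) (Ici R) :=
    hC.mono (Ici_subset_Ici.2 (le_max_left _ _))
  have hJR := hJ.pos R hR
  obtain ⟨I, hImono, hIR, hI, hI'⟩ := exists_monotone_inverse
    (hJ.contDiffOn.continuousOn.mono (Ici_subset_Ici.2 hR.le))
    (hJ.strictMonoOn.mono (Ici_subset_Ici.2 hR.le)) hJ.tendsto
  set m : EuclideanSpace ℝ (Fin N) → ℝ := fun x => max (u₀ x) R with hm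
  have hmm : Measurable m := hu₀m.max measurable_const
  have hJm : Measurable fun x => J (m x) := hJ.measurable_comp_max hR.le hu₀m
  have hmR : ∀ x, R ≤ m x := fun x => le_max_right _ _
  set Φ : EuclideanSpace ℝ (Fin N) → ℝ≥0∞ := fun y => ENNReal.ofReal (J (m y)) with hΦ
  have hΦm : Measurable Φ := hJm.ennreal_ofReal
  have hΦle : ∀ y, Φ y ≤ ENNReal.ofReal (J R) + ENNReal.ofReal (J (u₀ y)) := by
    intro y
    rcases le_total (u₀ y) R with h | h
    · simp only [hΦ, hm, max_eq_right h]
      exact le_self_add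
    · simp only [hΦ, hm, max_eq_left h]
      exact le_add_self
  obtain ⟨η₀, hη₀⟩ := eventually_atTop.1 htail
  -- For t < T the first bound absorbs J R + |M| into κ t^{-N/2}, giving 2S(t)J(m) ≤ 4κ t^{-N/2}.
  -- The second puts I(4κ t^{-N/2}) above η₀, where the tail estimate holds.
  obtain ⟨T, hT, hTB⟩ := exists_forall_le_mul_rpow hN hκ
    (max (J R + |M|) (J (max η₀ R)))
  have hw : ∀ s ∈ Ioo 0 T, ∀ y, 2 * heatS s Φ y ≤
      ENNReal.ofReal (4 * κ * s ^ (-(N : ℝ) / 2)) := by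
    intro s hs y
    have h1 := (le_max_left _ _).trans (hTB s hs)
    have h2 : heatS s Φ y ≤ ENNReal.ofReal (2 * (κ * s ^ (-(N : ℝ) / 2))) := by
      calc heatS s Φ y ≤ heatS s (fun y => ENNReal.ofReal (J R) + ENNReal.ofReal (J (u₀ y))) y :=
            heatS_mono hΦle _ _
        _ = ENNReal.ofReal (J R) + heatS s (fun y => ENNReal.ofReal (J (u₀ y))) y := by
            rw [heatS_add measurable_const, heatS_const _ hs.1]
        _ ≤ ENNReal.ofReal (J R) + ENNReal.ofReal (κ * s ^ (-(N : ℝ) / 2) + |M|) := by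
            gcongr
            refine (hdecay s ⟨hs.1, hs.2.le.trans hT.2⟩ y).trans (ENNReal.ofReal_le_ofReal ?_)
            linarith [le_abs_self M]
        _ ≤ _ := by
            have := hs.1
            rw [← ENNReal.ofReal_add hJR.le (by positivity)]
            exact ENNReal.ofReal_le_ofReal (by linarith)
    calc 2 * heatS s Φ y ≤ 2 * ENNReal.ofReal (2 * (κ * s ^ (-(N : ℝ) / 2))) := by gcongr
      _ = _ := by
        rw [← ENNReal.ofReal_ofNat 2, ← ENNReal.ofReal_mul two_pos.le]
        congr 1
        ring
  have htail' : ∀ t ∈ Ioo 0 T, ENNReal.ofReal (2 / N * (4 * κ) ^ (2 / (N : ℝ))) *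
      tailQuantity N f J θ R (I (4 * κ * t ^ (-(N : ℝ) / 2))) ≤ 1 / 2 := by
    intro t ht
    have h1 := (le_max_right _ _).trans (hTB t ht)
    have hη0R : 0 ≤ max η₀ R := hR.le.trans (le_max_right _ _)
    refine le_trans ?_ (hη₀ (I (4 * κ * t ^ (-(N : ℝ) / 2))) ?_)
    · gcongr
      exact tailQuantity_anti N f J θ _ hξR
    · have h0 := ht.1
      have h2 : 0 ≤ κ * t ^ (-(N : ℝ) / 2) := by positivity
      calc η₀ ≤ max η₀ R := le_max_left _ _
        _ = I (J (max η₀ R)) := (hI' _ (le_max_right _ _)).symm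
        _ ≤ _ := hImono (by linarith)
  have hsuper := fun t (ht : t ∈ Ioo 0 T) x => hJ.duhamel_le hN hR hmono hmm hJm hmR hImono hIR
    hI hI' (f := f) hθ (u₀ := u₀) (fun y => le_max_left _ _) (by positivity) hw htail' ht x
  obtain ⟨u, hum, hu0, hu⟩ := exists_solution_le_supersolution hf hfmono hu₀m
    (fun t _ x => hR.le.trans (hIR _)) hsuper
  have hfin : ∀ s ∈ Ioo 0 T, ∀ y, heatS s Φ y ≠ ∞ := fun s hs y h => by
    have := hw s hs y
    rw [h, ENNReal.mul_top two_ne_zero] at this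
    exact ENNReal.ofReal_ne_top (top_le_iff.1 this)
  have hlow : ∀ s ∈ Ioo 0 T, ∀ y, J R ≤ (heatS s Φ y).toReal := fun s hs y =>
    (ENNReal.ofReal_le_iff_le_toReal (hfin s hs y)).1 (hJ.ofReal_le_heatS hR.le hmR hs.1 y)
  have hJI : ∀ t ∈ Ioo 0 T, ∀ x, J (I (2 * (heatS t Φ x).toReal)) = 2 * (heatS t Φ x).toReal :=
    fun t ht x => hI _ (by linarith [hlow t ht x])
  have hofReal : ∀ t ∈ Ioo 0 T, ∀ x, ENNReal.ofReal (2 * (heatS t Φ x).toReal) =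
      2 * heatS t Φ x := fun t ht x => by
    rw [ENNReal.ofReal_mul two_pos.le, ENNReal.ofReal_toReal (hfin t ht x), ENNReal.ofReal_ofNat]
  set B : ℝ≥0∞ := ENNReal.ofReal (J R) *
    volume (Metric.ball (0 : EuclideanSpace ℝ (Fin N)) 1) +
      ulMass (fun x => ENNReal.ofReal (J (u₀ x))) with hB
  have hBtop : B ≠ ∞ := ENNReal.add_ne_top.2
    ⟨ENNReal.mul_ne_top ENNReal.ofReal_ne_top measure_ball_lt_top.ne, hul.ne⟩
  have hBle : ∀ t ∈ Ioo 0 T, ulMass (heatS t Φ) ≤ B := fun t ht =>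
    (ulMass_heatS_le hΦm ht.1).trans ((ulMass_mono hΦle).trans (ulMass_const_add_le _ _))
  have hut : ∀ t, Measurable (u t) := fun t => hum.comp measurable_prodMk_left
  have hJu : ∀ t ∈ Ioo 0 T, ulNorm 1 (fun x => J (u t x)) ≤ 2 * B := by
    intro t ht
    rw [ulNorm_one_eq_ulMass]
    calc ulMass (fun x => ‖J (u t x)‖ₑ) ≤ ulMass (fun x => 2 * heatS t Φ x) := by
          refine ulMass_mono fun x => ?_
          rw [Real.enorm_eq_ofReal (hJ.nonneg (hu0 t x)), ← hofReal t ht x, ← hJI t ht x]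
          exact ENNReal.ofReal_le_ofReal (hJ.strictMonoOn.monotoneOn (hu0 t x)
            (hR.le.trans (hIR _)) (hu t ht x).1)
      _ = 2 * ulMass (heatS t Φ) := ulMass_const_mul ENNReal.ofNat_ne_top _
      _ ≤ 2 * B := by gcongr; exact hBle t ht
  set d := derivWithin J (Ici 0) R with hd
  have hd0 : 0 < d := hJ.deriv_pos R hR
  set B' : ℝ≥0∞ := ENNReal.ofReal R * volume (Metric.ball (0 : EuclideanSpace ℝ (Fin N)) 1) +
    ENNReal.ofReal (d⁻¹ * 2) * B with hB'
  have hB'top : B' ≠ ∞ := ENNReal.add_ne_top.2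
    ⟨ENNReal.mul_ne_top ENNReal.ofReal_ne_top measure_ball_lt_top.ne,
      ENNReal.mul_ne_top ENNReal.ofReal_ne_top hBtop⟩
  have hu1 : ∀ t ∈ Ioo 0 T, ulNorm 1 (u t) ≤ B' := by
    intro t ht
    rw [ulNorm_one_eq_ulMass]
    calc ulMass (fun x => ‖u t x‖ₑ)
        ≤ ulMass (fun x => ENNReal.ofReal R + ENNReal.ofReal (d⁻¹ * 2) * heatS t Φ x) := by
          refine ulMass_mono fun x => ?_
          have hW0 : 0 ≤ (heatS t Φ x).toReal := ENNReal.toReal_nonneg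
          rw [Real.enorm_eq_ofReal (hu0 t x)]
          rw [← ENNReal.ofReal_toReal (hfin t ht x), ← ENNReal.ofReal_mul (by positivity), ← ENNReal.ofReal_add hR.le (by positivity)]
          refine ENNReal.ofReal_le_ofReal ((hu t ht x).1.trans ?_)
          -- By convexity J grows at least linearly beyond R, with slope d = J'(R) > 0, so control
          -- of J(w) controls w and hence u.
          have h1 := hJ.tangent_le hR hmono (hIR (2 * (heatS t Φ x).toReal)) (le_refl R)
          rw [hJI t ht x, ← hd] at h1
          have h2 : I (2 * (heatS t Φ x).toReal) - R ≤ d⁻¹ * (2 * (heatS t Φ x).toReal) := by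
            rw [inv_mul_eq_div, le_div_iff₀ hd0]
            linarith
          linarith
      _ ≤ _ := (ulMass_const_add_le _ _).trans (by
          rw [ulMass_const_mul ENNReal.ofReal_ne_top]
          exact add_le_add le_rfl (mul_le_mul_right (hBle t ht) _))
  refine ⟨T, u, hT.1, hu0, ⟨hum.aemeasurable, fun t _ => Eventually.of_forall (hu0 t), ?_, ?_,
    fun t ht => Eventually.of_forall fun x => (hu t ht x).2⟩, (2 * B).toReal + 1, by positivity,
    fun t ht => ⟨⟨?_, ?_⟩, ?_⟩⟩
  · refine ⟨B'.toNNReal, (ae_restrict_iff' measurableSet_Ioo).2 (Eventually.of_forall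
      fun t ht => ?_)⟩
    rw [ENNReal.coe_toNNReal hB'top]
    exact ⟨⟨(hut t).aestronglyMeasurable, (hu1 t ht).trans_lt hB'top.lt_top⟩, hu1 t ht⟩
  · intro a b ha hb
    refine ⟨(I (4 * κ * a ^ (-(N : ℝ) / 2))).toNNReal,
      (ae_restrict_iff' measurableSet_Icc).2 (Eventually.of_forall fun t ht => ?_)⟩
    have htT : t ∈ Ioo 0 T := ⟨ha.trans_le ht.1, ht.2.trans_lt hb⟩
    rw [eLpNorm_exponent_top]
    refine eLpNormEssSup_le_of_ae_bound (Eventually.of_forall fun x => ?_)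
    rw [Real.norm_of_nonneg (hu0 t x)]
    refine (hu t htT x).1.trans (hImono ?_)
    have h1 := hw t htT x
    rw [← hofReal t htT x] at h1
    have h0 := htT.1
    refine ((ENNReal.ofReal_le_ofReal_iff (by positivity)).1 h1).trans ?_
    exact mul_le_mul_of_nonneg_left (Real.rpow_le_rpow_of_nonpos ha ht.1
      (by rw [neg_div]; exact neg_nonpos.2 (by positivity))) (by positivity)
  · have h1 : (fun x => J (u t x)) = fun x => J (max (u t x) 0) := by
      funext x
      rw [max_eq_left (hu0 t x)]
    rw [h1]
    exact (hJ.measurable_comp_max le_rfl (hut t)).aestronglyMeasurable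
  · exact (hJu t ht).trans_lt (ENNReal.mul_ne_top ENNReal.ofNat_ne_top hBtop).lt_top
  · refine (hJu t ht).trans ?_
    rw [ENNReal.le_ofReal_iff_toReal_le (ENNReal.mul_ne_top ENNReal.ofNat_ne_top hBtop)
      (by positivity)]
    linarith

/-- The smoothing estimate for almost everywhere measurable functions. -/
theorem exists_heatS_le_ulMass_of_aemeasurable (N : ℕ) : ∃ C : ℝ, 0 < C ∧
    ∀ φ : EuclideanSpace ℝ (Fin N) → ℝ≥0∞, AEMeasurable φ → ∀ t ∈ Ioc (0 : ℝ) 1, ∀ x,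
      heatS t φ x ≤ ENNReal.ofReal (C * t ^ (-(N : ℝ) / 2)) * ulMass φ := by
  obtain ⟨C, hC, h⟩ := exists_heatS_le_ulMass N
  refine ⟨C, hC, fun φ hφ t ht x => ?_⟩
  rw [heatS_congr_ae hφ.ae_eq_mk]
  refine (h _ hφ.measurable_mk t ht x).trans ?_
  gcongr
  exact ulMass_mono_ae (hφ.ae_eq_mk.mono fun y hy => hy.ge)

theorem MemUL.exists_decay {φ : EuclideanSpace ℝ (Fin N) → ℝ} (h : MemUL 1 φ) :
    ∃ κ : ℝ, 0 < κ ∧ ∀ t ∈ Ioc (0 : ℝ) 1, ∀ x, heatS t (fun y => ENNReal.ofReal (φ y)) x ≤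
      ENNReal.ofReal (κ * t ^ (-(N : ℝ) / 2)) := by
  obtain ⟨C, hC, hS⟩ := exists_heatS_le_ulMass_of_aemeasurable N
  -- The added 1 keeps κ positive when the norm vanishes.
  refine ⟨C * ((ulNorm 1 φ).toReal + 1), by positivity, fun t ht x => ?_⟩
  have ht0 := ht.1
  have h1 : ulNorm 1 φ ≤ ENNReal.ofReal ((ulNorm 1 φ).toReal + 1) := by
    rw [ENNReal.le_ofReal_iff_toReal_le h.2.ne (by positivity)]
    linarith
  calc heatS t (fun y => ENNReal.ofReal (φ y)) x
      ≤ heatS t (fun y => ‖φ y‖ₑ) x := heatS_mono (fun y => Real.ofReal_le_enorm _) _ _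
    _ ≤ ENNReal.ofReal (C * t ^ (-(N : ℝ) / 2)) * ulNorm 1 φ := by
        rw [ulNorm_one_eq_ulMass]
        exact hS _ h.1.enorm t ht x
    _ ≤ ENNReal.ofReal (C * t ^ (-(N : ℝ) / 2)) * ENNReal.ofReal ((ulNorm 1 φ).toReal + 1) := by
        gcongr
    _ = _ := by
        rw [← ENNReal.ofReal_mul (by positivity)]
        congr 1
        ring

/-- Splitting φ into a bounded function and a remainder of small mass, only the remainder feels the
t^{-N/2} singularity; hence κ is arbitrary, at the price of M. -/
theorem MemULClosure.exists_decay {φ : EuclideanSpace ℝ (Fin N) → ℝ} (h : MemULClosure 1 φ)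
    {κ : ℝ} (hκ : 0 < κ) :
    ∃ M : ℝ, ∀ t ∈ Ioc (0 : ℝ) 1, ∀ x, heatS t (fun y => ENNReal.ofReal (φ y)) x ≤
      ENNReal.ofReal (κ * t ^ (-(N : ℝ) / 2) + M) := by
  obtain ⟨C, hC, hS⟩ := exists_heatS_le_ulMass_of_aemeasurable N
  obtain ⟨g, hg, ⟨M, hM⟩, hφg⟩ := h.2 (ENNReal.ofReal (κ / C))
    (ENNReal.ofReal_pos.2 (by positivity))
  refine ⟨M, fun t ht x => ?_⟩
  have ht0 := ht.1
  have hM0 : 0 ≤ M := (abs_nonneg _).trans (hM 0)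
  have hmeas : AEStronglyMeasurable (fun y => φ y - g y) volume :=
    h.1.1.sub hg.continuous.aestronglyMeasurable
  calc heatS t (fun y => ENNReal.ofReal (φ y)) x
      ≤ heatS t (fun y => ENNReal.ofReal M + ‖φ y - g y‖ₑ) x := by
        refine heatS_mono (fun y => ?_) _ _
        rw [Real.enorm_eq_ofReal_abs, ← ENNReal.ofReal_add hM0 (abs_nonneg _)]
        refine ENNReal.ofReal_le_ofReal ?_
        linarith [le_abs_self (φ y - g y), le_abs_self (g y), hM y]
    _ = ENNReal.ofReal M + heatS t (fun y => ‖φ y - g y‖ₑ) x := by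
        rw [heatS_add measurable_const, heatS_const _ ht0]
    _ ≤ ENNReal.ofReal M +
          ENNReal.ofReal (C * t ^ (-(N : ℝ) / 2)) * ulNorm 1 (fun y => φ y - g y) := by
        gcongr
        rw [ulNorm_one_eq_ulMass]
        exact hS _ hmeas.enorm t ht x
    _ ≤ ENNReal.ofReal M + ENNReal.ofReal (C * t ^ (-(N : ℝ) / 2)) * ENNReal.ofReal (κ / C) := by
        gcongr
    _ = _ := by
        rw [← ENNReal.ofReal_mul (by positivity), ← ENNReal.ofReal_add hM0 (by positivity)]
        congr 1
        field_simp
        ring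

/-- In either case of the theorem, `S(t)φ` decays fast enough for the source term. -/
theorem exists_decay_and_tail_le (hN : 1 ≤ N) {φ : EuclideanSpace ℝ (Fin N) → ℝ} {Q : ℝ → ℝ≥0∞}
    (h : (MemUL 1 φ ∧ Tendsto Q atTop (𝓝 0)) ∨ (MemULClosure 1 φ ∧ limsup Q atTop < ∞)) :
    ∃ κ M : ℝ, 0 < κ ∧ (∀ t ∈ Ioc (0 : ℝ) 1, ∀ x,
      heatS t (fun y => ENNReal.ofReal (φ y)) x ≤
        ENNReal.ofReal (κ * t ^ (-(N : ℝ) / 2) + M)) ∧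
      ∀ᶠ η in atTop, ENNReal.ofReal (2 / N * (4 * κ) ^ (2 / (N : ℝ))) * Q η ≤ 1 / 2 := by
  have hN0 : (0 : ℝ) < N := by exact_mod_cast hN
  rcases h with ⟨hφ, hQ⟩ | ⟨hφ, hQ⟩
  · obtain ⟨κ, hκ, hdecay⟩ := hφ.exists_decay
    refine ⟨κ, 0, hκ, by simpa using hdecay, ?_⟩
    have h1 := ENNReal.Tendsto.const_mul (a := ENNReal.ofReal (2 / N * (4 * κ) ^ (2 / (N : ℝ)))) hQ
      (Or.inr ENNReal.ofReal_ne_top)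
    rw [mul_zero] at h1
    exact h1.eventually_le_const (by norm_num)
  · obtain ⟨L, hL, hLtop⟩ := exists_between hQ
    have hev := eventually_lt_of_limsup_lt hL
    set l := L.toReal + 1 with hl
    have hl0 : 0 < l := by positivity
    -- Chosen so that (4κ)^{2/N} = N/(4l): the prefactor becomes 1/(2l), against Q ≤ l.
    set κ : ℝ := (N / (4 * l)) ^ ((N : ℝ) / 2) / 4 with hκdef
    have hκ : 0 < κ := by positivity
    obtain ⟨M, hM⟩ := hφ.exists_decay hκ
    refine ⟨κ, M, hκ, hM, hev.mono fun η hη => ?_⟩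
    have h1 : 2 / N * (4 * κ) ^ (2 / (N : ℝ)) = 1 / (2 * l) := by
      rw [hκdef, mul_div_cancel₀ _ (by norm_num : (4 : ℝ) ≠ 0), ← Real.rpow_mul (by positivity),
        show (N : ℝ) / 2 * (2 / N) = 1 by field_simp, Real.rpow_one]
      field_simp
      norm_num
    have h2 : Q η ≤ ENNReal.ofReal l := by
      refine hη.le.trans ?_
      rw [ENNReal.le_ofReal_iff_toReal_le hLtop.ne hl0.le]
      linarith
    calc _ ≤ ENNReal.ofReal (1 / (2 * l)) * ENNReal.ofReal l := by rw [h1]; gcongr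
      _ = ENNReal.ofReal (1 / 2) := by
        rw [← ENNReal.ofReal_mul (by positivity)]
        congr 1
        field_simp
      _ = 1 / 2 := by
        rw [ENNReal.ofReal_div_of_pos two_pos, ENNReal.ofReal_one, ENNReal.ofReal_ofNat]
      _ ≤ 1 / 2 := le_rfl

end Existence

/-! ### Reduction to a measurable datum and a nonlinearity defined on all of ℝ. -/

theorem duhamel_congr {N : ℕ} {f g : ℝ → ℝ} {u₀ v₀ : EuclideanSpace ℝ (Fin N) → ℝ}
    {u : ℝ → EuclideanSpace ℝ (Fin N) → ℝ} (h₀ : u₀ =ᵐ[volume] v₀)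
    (h : ∀ s x, f (u s x) = g (u s x)) (t : ℝ) (x : EuclideanSpace ℝ (Fin N)) :
    duhamel f u₀ u t x = duhamel g v₀ u t x := by
  unfold duhamel
  simp_rw [h]
  rw [heatS_congr_ae (h₀.mono fun y hy => by rw [hy])]

theorem theorem3p1 (N : ℕ) (hN : 1 ≤ N)
    (u₀ : EuclideanSpace ℝ (Fin N) → ℝ) (hu₀_meas : AEMeasurable u₀ volume)
    (hu₀ : ∀ᵐ x, 0 ≤ u₀ x)
    (f : ℝ → ℝ) (hf_cont : ContinuousOn f (Ici 0)) (hf_nonneg : ∀ τ, 0 ≤ τ → 0 ≤ f τ)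
    (hf_mono : MonotoneOn f (Ioi 0))
    (J : ℝ → ℝ) (hJ : ConditionJ J)
    (θ ξ : ℝ) (hθ : θ ∈ Ioc (0 : ℝ) 1) (hξ : 0 ≤ ξ)
    (h : (MemUL 1 (fun x => J (u₀ x)) ∧ Tendsto (tailQuantity N f J θ ξ) atTop (𝓝 0)) ∨
      (MemULClosure 1 (fun x => J (u₀ x)) ∧ limsup (tailQuantity N f J θ ξ) atTop < ∞)) :
    ∃ (T : ℝ) (u : ℝ → EuclideanSpace ℝ (Fin N) → ℝ), 0 < T ∧ IsNonnegSolution f u₀ T u ∧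
      ∃ C₀ : ℝ, 0 < C₀ ∧ ∀ t ∈ Ioo 0 T,
        MemUL 1 (fun x => J (u t x)) ∧ ulNorm 1 (fun x => J (u t x)) ≤ ENNReal.ofReal C₀ := by
  obtain ⟨κ, M, hκ, hdecay, htail⟩ := exists_decay_and_tail_le hN h
  have hul : ulNorm 1 (fun x => J (u₀ x)) < ∞ := h.elim (fun h => h.1.2) fun h => h.1.1.2
  set v₀ : EuclideanSpace ℝ (Fin N) → ℝ := hu₀_meas.mk u₀ with hv₀
  have huv : u₀ =ᵐ[volume] v₀ := hu₀_meas.ae_eq_mk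
  -- Extending f by f(0) to the left makes it continuous and monotone on ℝ; nothing changes on
  -- nonnegative solutions.
  set g : ℝ → ℝ := fun τ => f (max τ 0) with hg
  have hgf : ∀ τ, 0 ≤ τ → g τ = f τ := fun τ hτ => by simp only [hg, max_eq_left hτ]
  have hgcont : Continuous g := hf_cont.comp_continuous (continuous_id.max continuous_const)
    fun τ => mem_Ici.2 (le_max_right _ _)
  -- Monotonicity on (0,∞) passes to 0 by continuity.
  have hfmono : MonotoneOn f (Ici 0) := by
    intro a ha b hb hab
    rcases (mem_Ici.1 ha).eq_or_lt with rfl | ha'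
    · rcases hab.eq_or_lt with rfl | hb'
      · exact le_rfl
      · refine le_of_tendsto ((hf_cont 0 self_mem_Ici).mono_left
          (nhdsWithin_mono _ Ioi_subset_Ici_self)) ?_
        filter_upwards [Ioo_mem_nhdsGT hb'] with τ hτ
        exact hf_mono hτ.1 hb' hτ.2.le
    · exact hf_mono ha' (ha'.trans_le hab) hab
  have hgmono : Monotone g := fun a b hab =>
    hfmono (mem_Ici.2 (le_max_right _ _)) (mem_Ici.2 (le_max_right _ _)) (max_le_max_right _ hab)
  have htail_eq : ∀ η, tailQuantity N g J θ ξ η = tailQuantity N f J θ ξ η := by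
    intro η
    have h1 : ∀ τ, fTilde g J θ ξ τ = fTilde f J θ ξ τ := fun τ =>
      iSup_congr fun σ => iSup_congr fun hσ => by rw [hgf σ (hξ.trans hσ.1)]
    simp only [tailQuantity, h1]
  obtain ⟨T, u, hT, hu0, hu, hC⟩ := hJ.exists_solution_of_decay hN hu₀_meas.measurable_mk hgcont
    hgmono hθ (ξ := ξ) (κ := κ) (M := M) (by
      refine lt_of_le_of_lt ?_ hul
      rw [ulNorm_one_eq_ulMass]
      refine ulMass_mono_ae (huv.mono fun x hx => ?_)
      rw [hx]
      exact Real.ofReal_le_enorm _) hκ (fun t ht x => by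
      rw [heatS_congr_ae (ψ := fun y => ENNReal.ofReal (J (u₀ y)))
        (huv.mono fun y hy => by simp only [hy, hv₀])]
      exact hdecay t ht x) (by simpa only [htail_eq] using htail)
  refine ⟨T, u, hT, ⟨hu.aemeasurable, hu.nonneg, hu.bounded_ul, hu.locBounded_top,
    fun t ht => (hu.equation t ht).mono fun x hx => ?_⟩, hC⟩
  rw [hx, duhamel_congr huv fun s x => (hgf _ (hu0 s x)).symm]
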